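/- Let $d\ge 1$, $n\ge 14$, $x_1,\dots,x_n\in[0,1]^d$, and observe $Y=(Y_1,\dots,Y_n)$, $Y_i=\mu_i+\sigma\varepsilon_i$, where $\mu_i=f(x_i)$, $\sigma>0$ and $\varepsilon_1,\dots,\varepsilon_n$ are i.i.d. standard Gaussian. **Models.** Let $\mathcal M$ be the set of all $m=(s,k_1,\dots,k_d)$ with $s\in\mathbb N=\{0,1,\dots\}$, $k_i\ge 1$ and $(s+1)^dk_1\cdots k_d\le n-2$. For $m\in\mathcal M$ let $\mathcal F_m$ be the space of functions $P$ whose restriction to each hyperrectangle $\prod_{i=1}^d[(j_i-1)/k_i,\,j_i/k_i)$, $1\le j_i\le k_i$ (the last interval in each direction also containing its right end point $1$), is a polynomial in $d$ variables of degree at most $s$ in each variable. Put $S_m=\{(P(x_1),\dots,P(x_n)):P\in\mathcal F_m\}\subset\mathbb R^n$, $D_m=\dim S_m$, $N_m=n-D_m$, and let $\Pi_m$ be the orthogonal projector onto $S_m$. **Procedure.** Fix $K>1$ and put $L_m=(s+1)^dk_1\cdots k_d$ and $$\mathrm{pen}(m)=K\,\frac{N_m}{N_m-1}\,\mathrm{EDkhi}\big[D_m+1,N_m-1,e^{-L_m}\big],$$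 where, for independent $\chi^2$ variables $X_D,X_N$ with $D$ and $N$ degrees of freedom, $\mathrm{Dkhi}[D,N,u]=\mathbb E(X_D)^{-1}\,\mathbb E\big[(X_D-uX_N/N)_+\big]$ and, for $0<q\le1$, $\mathrm{EDkhi}[D,N,q]$ is the unique $u\ge0$ with $\mathrm{Dkhi}[D,N,u]=q$. Let $\hat m=\hat m(Y)$ be a (measurable) selection which almost surely minimizes over $\mathcal M$ the criterion $\|Y-\Pi_mY\|^2\big(1+\mathrm{pen}(m)/N_m\big)$, and let $\hat\mu=\Pi_{\hat m}Y$. **Hölder classes.** For $\underline\alpha,\underline R\in(0,\infty)^d$ write $\alpha_i=r_i+\beta_i$ with $r_i\in\mathbb N$, $0<\beta_i\le1$. Let $\mathcal H(\underline\alpha,\underline R)$ be the set of $f:[0,1]^d\to\mathbb R$ such that for every $i$ the partial derivative $\partial^{r_i}f/\partial t_i^{r_i}$ exists on $[0,1]^d$ and $$\Big|\tfrac{\partial^{r_i}}{\partial t_i^{r_i}}f(t_1,\dots,t_i,\dots,t_d)-\tfrac{\partial^{r_i}}{\partial t_i^{r_i}}f(t_1,\dots,z_i,\dots,t_d)\Big|\le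 R_i|t_i-z_i|^{\beta_i}$$ for all $t_1,\dots,t_d,z_i\in[0,1]$. Put $$r=\max_i r_i,\qquad \alpha=\Big(\frac1d\sum_{i=1}^d\frac1{\alpha_i}\Big)^{-1},\qquad R=\Big(\prod_{i=1}^dR_i^{\alpha/\alpha_i}\Big)^{1/d}.$$ **Statement.** There is a constant $C$ depending only on $K$, $r$ and $d$ such that, whenever for all $i=1,\dots,d$ $$n^\alpha R_i^{2\alpha+d}\ge R^d\sigma^{2\alpha}\qquad\text{and}\qquad n^\alpha R_i^d\ge 2^\alpha R^d(r+1)^{d\alpha},$$ one has, for every $f\in\mathcal H(\underline\alpha,\underline R)$ and with $\|v\|_n^2=\|v\|^2/n$, $$\mathbb E\big[\|\mu-\hat\mu\|_n^2\big]\le C\left[\Big(\frac{R^{d/\alpha}\sigma^2}{n}\Big)^{2\alpha/(2\alpha+d)}\vee\frac{R^2}{n^{2\alpha/d}}\right].$$ -/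

import Mathlib

open MeasureTheory ProbabilityTheory

noncomputable section

namespace SignalEstimation

/-! ### Anisotropic Hölder classes -/

/-- The integer part `r` in the decomposition `a = r + β`, `r ∈ ℕ`, `0 < β ≤ 1`, of a positive
real number `a`, that is `r = ⌈a⌉ - 1`. -/
def holderOrder (a : ℝ) : ℕ := ⌈a⌉₊ - 1

/-- The remaining part `β ∈ (0, 1]` in the decomposition `a = r + β`. -/
def holderExponent (a : ℝ) : ℝ := a - holderOrder a

/-- The largest of the integers `r₁, …, r_d` attached to `α₁, …, α_d`. -/
def maxOrder {d : ℕ} (α : Fin d → ℝ) : ℕ := Finset.univ.sup fun i => holderOrder (α i)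

/-- The harmonic mean `(d⁻¹ ∑ᵢ 1 / αᵢ)⁻¹` of `α₁, …, α_d`. -/
def meanSmoothness {d : ℕ} (α : Fin d → ℝ) : ℝ := ((1 / (d : ℝ)) * ∑ i, 1 / α i)⁻¹

/-- The mean radius `(∏ᵢ Rᵢ ^ (α / αᵢ)) ^ (1 / d)`, with `α` the harmonic mean of the `αᵢ`. -/
def meanRadius {d : ℕ} (α R : Fin d → ℝ) : ℝ :=
  (∏ i, R i ^ (meanSmoothness α / α i)) ^ (1 / (d : ℝ))

/-- The unit cube `[0, 1]^d`. -/
def unitCube (d : ℕ) : Set (Fin d → ℝ) := {t | ∀ i, t i ∈ Set.Icc (0 : ℝ) 1}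

/-- The restriction of `f` to the line through `t` parallel to the `i`-th axis. -/
def slice {d : ℕ} (f : (Fin d → ℝ) → ℝ) (t : Fin d → ℝ) (i : Fin d) : ℝ → ℝ :=
  fun s => f (Function.update t i s)

/-- The `(α, R)`-Hölderian functions on `[0, 1]^d`: in each coordinate `i` the function is
`rᵢ` times (continuously) differentiable on `[0, 1]`, and its `rᵢ`-th partial derivative is
`βᵢ`-Hölder in that coordinate, with constant `Rᵢ`. Only values on the cube matter. -/
def holderClass {d : ℕ} (α R : Fin d → ℝ) : Set ((Fin d → ℝ) → ℝ) :=
  {f | ∀ i, ∀ t ∈ unitCube d,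
    ContDiffOn ℝ (holderOrder (α i)) (slice f t i) (Set.Icc 0 1) ∧
    ∀ s ∈ Set.Icc (0 : ℝ) 1, ∀ z ∈ Set.Icc (0 : ℝ) 1,
      |iteratedDerivWithin (holderOrder (α i)) (slice f t i) (Set.Icc 0 1) s
        - iteratedDerivWithin (holderOrder (α i)) (slice f t i) (Set.Icc 0 1) z|
        ≤ R i * |s - z| ^ holderExponent (α i)}

/-! ### Piecewise polynomial models -/

/-- The cell with (zero-based) index `j` of the regular partition of `[0, 1]^d` into
`k₁ ⋯ k_d` hyperrectangles: the product of the intervals `[jᵢ / kᵢ, (jᵢ + 1) / kᵢ)`, where the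
last interval in each direction also contains its right end point `1`. -/
def cell {d : ℕ} (k : Fin d → ℕ) (j : ∀ i, Fin (k i)) : Set (Fin d → ℝ) :=
  {t | ∀ i, ((j i : ℕ) : ℝ) / (k i : ℝ) ≤ t i ∧
    (t i < (((j i : ℕ) : ℝ) + 1) / (k i : ℝ) ∨ ((j i : ℕ) + 1 = k i ∧ t i = 1))}

/-- The space of functions whose restriction to each cell is a polynomial in `d` variables of
degree at most `r` in each of the variables. -/
def piecewisePolynomials {d : ℕ} (r : ℕ) (k : Fin d → ℕ) :
    Submodule ℝ ((Fin d → ℝ) → ℝ) where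
  carrier := {g | ∀ j : (∀ i, Fin (k i)), ∃ p ∈ MvPolynomial.restrictDegree (Fin d) ℝ r,
    ∀ t ∈ cell k j, g t = MvPolynomial.eval t p}
  zero_mem' := fun _ => ⟨0, Submodule.zero_mem _, fun _ _ => by simp⟩
  add_mem' := by
    intro g h hg hh j
    obtain ⟨p, hp, hgp⟩ := hg j
    obtain ⟨q, hq, hhq⟩ := hh j
    exact ⟨p + q, Submodule.add_mem _ hp hq, fun t ht => by simp [hgp t ht, hhq t ht]⟩
  smul_mem' := by
    intro c g hg j
    obtain ⟨p, hp, hgp⟩ := hg j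
    exact ⟨c • p, Submodule.smul_mem _ c hp, fun t ht => by simp [hgp t ht]⟩

/-- The evaluation of a function at the design points, `g ↦ (g(x₁), …, g(xₙ))`. -/
def evalAt {d n : ℕ} (x : Fin n → Fin d → ℝ) :
    ((Fin d → ℝ) → ℝ) →ₗ[ℝ] EuclideanSpace ℝ (Fin n) where
  toFun g := WithLp.toLp 2 fun i => g (x i)
  map_add' _ _ := rfl
  map_smul' _ _ := rfl

/-- The index set of the models: the tuples `(r, k₁, …, k_d)` with `r ∈ ℕ`, `kᵢ ≥ 1` and
`(r + 1)^d k₁ ⋯ k_d ≤ n - 2`. -/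
abbrev ModelIndex (d n : ℕ) : Type :=
  {m : ℕ × (Fin d → ℕ) // (∀ i, 1 ≤ m.2 i) ∧ (m.1 + 1) ^ d * (∏ i, m.2 i) + 2 ≤ n}

/-- The model `S_m ⊆ ℝⁿ`. -/
def model {d n : ℕ} (x : Fin n → Fin d → ℝ) (m : ModelIndex d n) :
    Submodule ℝ (EuclideanSpace ℝ (Fin n)) :=
  (piecewisePolynomials m.1.1 m.1.2).map (evalAt x)

/-- The dimension `D_m` of the model `S_m`. -/
def modelDim {d n : ℕ} (x : Fin n → Fin d → ℝ) (m : ModelIndex d n) : ℕ :=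
  Module.finrank ℝ (model x m)

/-- The codimension `N_m = n - D_m` of the model `S_m`. -/
def modelCodim {d n : ℕ} (x : Fin n → Fin d → ℝ) (m : ModelIndex d n) : ℕ :=
  n - modelDim x m

/-- The weight `L_m = (r + 1)^d k₁ ⋯ k_d`. -/
def weight {d n : ℕ} (m : ModelIndex d n) : ℕ := (m.1.1 + 1) ^ d * ∏ i, m.1.2 i

/-! ### The penalty -/

/-- The `χ²` law with `k` degrees of freedom: the law of the sum of the squares of `k`
independent standard Gaussian variables. -/
def chiSq (k : ℕ) : Measure ℝ :=
  (Measure.pi fun _ : Fin k => gaussianReal 0 1).map fun z => ∑ i, z i ^ 2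

/-- `Dkhi[D, N, u] = E[X_D]⁻¹ E[(X_D - u X_N / N)₊]` for independent `χ²` variables `X_D` and
`X_N` with `D` and `N` degrees of freedom. -/
def dkhi (D N : ℕ) (u : ℝ) : ℝ :=
  (1 / ∫ a, a ∂(chiSq D)) *
    ∫ p, max (p.1 - u * (p.2 / (N : ℝ))) 0 ∂((chiSq D).prod (chiSq N))

/-- `EDkhi[D, N, q]`, for `0 < q ≤ 1`: the unique solution `u ≥ 0` of `Dkhi[D, N, u] = q`
(the set below has exactly one element for `D, N ≥ 1`). -/
def edkhi (D N : ℕ) (q : ℝ) : ℝ := sInf {u | 0 ≤ u ∧ dkhi D N u = q}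

/-- The penalty `pen(m) = K N_m / (N_m - 1) EDkhi[D_m + 1, N_m - 1, exp(-L_m)]`. -/
def penalty {d n : ℕ} (K : ℝ) (x : Fin n → Fin d → ℝ) (m : ModelIndex d n) : ℝ :=
  K * ((modelCodim x m : ℝ) / ((modelCodim x m : ℝ) - 1)) *
    edkhi (modelDim x m + 1) (modelCodim x m - 1) (Real.exp (-(weight m : ℝ)))

/-! ### The estimator -/

/-- The least-squares estimator relative to `S_m`: the orthogonal projection of `y` on `S_m`. -/
def leastSquares {d n : ℕ} (x : Fin n → Fin d → ℝ) (m : ModelIndex d n)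
    (y : EuclideanSpace ℝ (Fin n)) : EuclideanSpace ℝ (Fin n) :=
  (model x m).starProjection y

/-- The penalized criterion `‖y - Π_m y‖² (1 + pen(m) / N_m)`. -/
def criterion {d n : ℕ} (K : ℝ) (x : Fin n → Fin d → ℝ) (y : EuclideanSpace ℝ (Fin n))
    (m : ModelIndex d n) : ℝ :=
  ‖y - leastSquares x m y‖ ^ 2 * (1 + penalty K x m / (modelCodim x m : ℝ))

/-- The mean vector `μ = (f(x₁), …, f(xₙ))`. -/
def meanVector {d n : ℕ} (f : (Fin d → ℝ) → ℝ) (x : Fin n → Fin d → ℝ) :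
    EuclideanSpace ℝ (Fin n) := evalAt x f

/-- The observation `Y = μ + σ ε`. -/
def observation {n : ℕ} {Ω : Type*} (μ : EuclideanSpace ℝ (Fin n)) (σ : ℝ)
    (ε : Fin n → Ω → ℝ) (ω : Ω) : EuclideanSpace ℝ (Fin n) :=
  WithLp.toLp 2 fun i => μ i + σ * ε i ω

end SignalEstimation

end

open SignalEstimation

namespace SignalEstimation

/-! ### Chi-square laws -/

section ChiSquare

/-! The proof combines an oracle inequality for the penalized criterion with anisotropic
approximation by piecewise polynomials.

Write `Y = μ + σ z`. For each model choose a deterministic subspace `V ⊇ S_m` containing `μ`, of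
dimension exactly `D_m + 1`. The error `w = μ - Π_m Y` lies in `V`, so the cross term `⟨w, z⟩` sees
only the part of the noise in `V`, while the residual is at least the part of `σ z` in `Vᗮ`.
Expanding the squared residual and applying weighted AM-GM to the cross term bounds `(1 - 1/K) ‖w‖²`
by the criterion, minus `σ² ‖z‖²`, plus `K σ²` times `‖Π_V z‖² - c ‖Π_{Vᗮ} z‖²` (`loss_le_of_mem`).
The two squared norms are independent `χ²` variables, and the penalty is tuned so that the positive
part of this difference has mean `(D_m + 1) exp (-L_m)`. These means sum to a constant depending on
`d` only (`sum_weight_le`), which handles the randomness of the selected index. Comparing with any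
fixed model gives `oracle_inequality`.

If `2 L_m ≤ n`, a Chernoff bound shows that the penalty is at most of order `L_m`
(`edkhi_exp_neg_le`). It remains to find a model with small bias and small `L_m`. Interpolating in
one coordinate after another gives a bias of order `∑ R_i k_i ^ (-α_i)`
(`exists_piecewisePolynomial_approx`). With `k_i = ⌊(R_i / η) ^ (1 / α_i)⌋` every direction
contributes order `η`, and there are at most `(R / η) ^ (d / α)` cells. The accuracy `η` is the
larger of the value balancing bias and variance and the value forced by `2 L_m ≤ n`
(`exists_accuracy`); these give the two terms of the rate. -/

lemma measurable_sum_sq (k : ℕ) : Measurable fun z : Fin k → ℝ => ∑ i, z i ^ 2 := by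
  fun_prop

instance isProbabilityMeasure_chiSq (k : ℕ) : IsProbabilityMeasure (chiSq k) :=
  Measure.isProbabilityMeasure_map (measurable_sum_sq k).aemeasurable

lemma ae_nonneg_chiSq (k : ℕ) : ∀ᵐ a ∂(chiSq k), 0 ≤ a := by
  rw [chiSq, ae_map_iff (measurable_sum_sq k).aemeasurable measurableSet_Ici]
  exact Filter.Eventually.of_forall fun z => Finset.sum_nonneg fun i _ => sq_nonneg _

lemma integrable_sq_gaussianReal : Integrable (fun x : ℝ => x ^ 2) (gaussianReal 0 1) := by
  have h := memLp_id_gaussianReal (μ := 0) (v := 1) 2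
  exact h.integrable_sq

lemma integral_sq_gaussianReal : ∫ x : ℝ, x ^ 2 ∂(gaussianReal 0 1) = 1 := by
  have h := variance_id_gaussianReal (μ := 0) (v := 1)
  rw [variance_eq_integral (by fun_prop)] at h
  simpa using h

lemma integrable_sum_sq_pi (k : ℕ) : Integrable (fun z : Fin k → ℝ => ∑ i, z i ^ 2)
    (Measure.pi fun _ : Fin k => gaussianReal 0 1) :=
  integrable_finsetSum _ fun _ _ =>
    integrable_comp_eval (X := fun _ : Fin k => ℝ) (f := fun x : ℝ => x ^ 2)
      integrable_sq_gaussianReal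

lemma integrable_id_chiSq (k : ℕ) : Integrable (fun a : ℝ => a) (chiSq k) := by
  rw [chiSq, integrable_map_measure (by fun_prop) (measurable_sum_sq k).aemeasurable]
  exact integrable_sum_sq_pi k

lemma integral_id_chiSq (k : ℕ) : ∫ a, a ∂(chiSq k) = k := by
  rw [chiSq, integral_map (measurable_sum_sq k).aemeasurable (by fun_prop), integral_finsetSum]
  · have (i : Fin k) : ∫ z : Fin k → ℝ, z i ^ 2 ∂(Measure.pi fun _ : Fin k => gaussianReal 0 1)
        = 1 := by
      rw [integral_comp_eval (X := fun _ : Fin k => ℝ) (μ := fun _ => gaussianReal 0 1)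
        (f := fun x : ℝ => x ^ 2) (by fun_prop), integral_sq_gaussianReal]
    simp [this]
  · exact fun _ _ => integrable_comp_eval (X := fun _ : Fin k => ℝ) (f := fun x : ℝ => x ^ 2)
      integrable_sq_gaussianReal

lemma integrable_exp_mul_sq_gaussianReal {t : ℝ} (ht : t < 1 / 2) :
    Integrable (fun x : ℝ => Real.exp (t * x ^ 2)) (gaussianReal 0 1) := by
  rw [gaussianReal_of_var_ne_zero _ one_ne_zero,
    integrable_withDensity_iff_integrable_smul₀' (by fun_prop)
      (Filter.Eventually.of_forall fun _ => by simp [gaussianPDF])]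
  have h : (fun x : ℝ => (gaussianPDF 0 1 x).toReal • Real.exp (t * x ^ 2))
      = fun x => (√(2 * Real.pi))⁻¹ * Real.exp (-(1 / 2 - t) * x ^ 2) := by
    ext x
    rw [toReal_gaussianPDF, gaussianPDFReal, smul_eq_mul, mul_assoc, ← Real.exp_add]
    congr 2
    · simp
    · simp; ring
  rw [h]
  exact (integrable_exp_neg_mul_sq (by linarith)).const_mul _

lemma integral_exp_mul_sq_gaussianReal {t : ℝ} (ht : t < 1 / 2) :
    ∫ x : ℝ, Real.exp (t * x ^ 2) ∂(gaussianReal 0 1) = (√(1 - 2 * t))⁻¹ := by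
  rw [integral_gaussianReal_eq_integral_smul one_ne_zero]
  have h : (fun x : ℝ => gaussianPDFReal 0 1 x • Real.exp (t * x ^ 2))
      = fun x => (√(2 * Real.pi))⁻¹ * Real.exp (-(1 / 2 - t) * x ^ 2) := by
    ext x
    rw [gaussianPDFReal, smul_eq_mul, mul_assoc, ← Real.exp_add]
    congr 2
    · simp
    · simp; ring
  rw [h, integral_const_mul, integral_gaussian, ← Real.sqrt_inv, ← Real.sqrt_inv,
    ← Real.sqrt_mul (by positivity)]
  congr 1
  have : (1 / 2 - t) ≠ 0 := by linarith
  have h2 : (1 - 2 * t) ≠ 0 := by linarith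
  have := Real.pi_ne_zero
  field_simp

lemma integrable_exp_mul_chiSq (k : ℕ) {t : ℝ} (ht : t < 1 / 2) :
    Integrable (fun a : ℝ => Real.exp (t * a)) (chiSq k) := by
  rw [chiSq, integrable_map_measure (by fun_prop) (measurable_sum_sq k).aemeasurable]
  have h : (fun a : ℝ => Real.exp (t * a)) ∘ (fun z : Fin k → ℝ => ∑ i, z i ^ 2)
      = fun z => ∏ i, Real.exp (t * z i ^ 2) := by
    ext z
    simp [Finset.mul_sum, Real.exp_sum]
  rw [h]
  exact Integrable.fintype_prod (f := fun _ : Fin k => fun x : ℝ => Real.exp (t * x ^ 2))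
    fun _ => integrable_exp_mul_sq_gaussianReal ht

lemma integral_exp_mul_chiSq (k : ℕ) {t : ℝ} (ht : t < 1 / 2) :
    ∫ a, Real.exp (t * a) ∂(chiSq k) = (√(1 - 2 * t))⁻¹ ^ k := by
  rw [chiSq, integral_map (measurable_sum_sq k).aemeasurable (by fun_prop)]
  have h : (fun z : Fin k → ℝ => Real.exp (t * ∑ i, z i ^ 2))
      = fun z => ∏ i, Real.exp (t * z i ^ 2) := by
    ext z
    simp [Finset.mul_sum, Real.exp_sum]
  rw [h, integral_fintype_prod_eq_prod (fun _ : Fin k => fun x : ℝ => Real.exp (t * x ^ 2))]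
  simp [integral_exp_mul_sq_gaussianReal ht]

variable {E : Type*} [NormedAddCommGroup E] [InnerProductSpace ℝ E] [FiniteDimensional ℝ E]
  [MeasurableSpace E] [BorelSpace E]

/-- Cochran's theorem: in an orthonormal basis adapted to `V ⊕ Vᗮ` the coordinates of a standard
Gaussian vector are i.i.d. standard, and the two norms use disjoint blocks of them. -/
lemma map_norm_sq_starProjection_stdGaussian (V : Submodule ℝ E) :
    (stdGaussian E).map (fun z => (‖V.starProjection z‖ ^ 2, ‖Vᗮ.starProjection z‖ ^ 2))
      = (chiSq (Module.finrank ℝ V)).prod (chiSq (Module.finrank ℝ Vᗮ)) := by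
  set b := ((stdOrthonormalBasis ℝ V).prod (stdOrthonormalBasis ℝ Vᗮ)).map
    V.orthogonalDecomposition.symm with hb
  have hbl (i) : b (Sum.inl i) = (stdOrthonormalBasis ℝ V i : E) := by simp [hb]
  have hbr (i) : b (Sum.inr i) = (stdOrthonormalBasis ℝ Vᗮ i : E) := by simp [hb]
  have key (W : Submodule ℝ E) (z : E) : ‖W.starProjection z‖ ^ 2
      = ∑ i, (inner ℝ (stdOrthonormalBasis ℝ W i : E) z) ^ 2 := by
    rw [Submodule.starProjection_apply]
    change ‖W.orthogonalProjectionOnto z‖ ^ 2 = _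
    rw [← (stdOrthonormalBasis ℝ W).sum_sq_norm_inner_right]
    refine Finset.sum_congr rfl fun i _ => ?_
    rw [Real.norm_eq_abs, sq_abs, Submodule.inner_orthogonalProjectionOnto_eq_of_mem_left]
  have hin (x : Fin (Module.finrank ℝ V) ⊕ Fin (Module.finrank ℝ Vᗮ) → ℝ) (j) :
      inner ℝ (b j) (∑ i, x i • b i) = x j := by
    rw [inner_sum]
    simp [inner_smul_right, orthonormal_iff_ite.mp b.orthonormal]
  have hm : Measurable fun z : E => (‖V.starProjection z‖ ^ 2, ‖Vᗮ.starProjection z‖ ^ 2) := by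
    fun_prop
  rw [stdGaussian_eq_map_pi_orthonormalBasis b, Measure.map_map hm (by fun_prop)]
  have hcomp : ((fun z : E => (‖V.starProjection z‖ ^ 2, ‖Vᗮ.starProjection z‖ ^ 2)) ∘
      fun x : Fin (Module.finrank ℝ V) ⊕ Fin (Module.finrank ℝ Vᗮ) → ℝ => ∑ i, x i • b i)
      = Prod.map (fun z => ∑ i, z i ^ 2) (fun z => ∑ i, z i ^ 2) ∘
        MeasurableEquiv.sumPiEquivProdPi (fun _ => ℝ) := by
    ext x
    · simp only [Function.comp, key, ← hbl, hin]
      rfl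
    · simp only [Function.comp, key, ← hbr, hin]
      rfl
  rw [hcomp, ← Measure.map_map (by fun_prop) (MeasurableEquiv.measurable _),
    (measurePreserving_sumPiEquivProdPi (X := fun _ => ℝ) fun _ => gaussianReal 0 1).map_eq,
    ← Measure.map_prod_map _ _ (by fun_prop) (by fun_prop)]
  rfl

lemma integrable_norm_sq_starProjection (V : Submodule ℝ E) :
    Integrable (fun z => ‖V.starProjection z‖ ^ 2) (stdGaussian E) := by
  have h := map_norm_sq_starProjection_stdGaussian V
  have h1 := (integrable_id_chiSq (Module.finrank ℝ V)).comp_fst (chiSq (Module.finrank ℝ Vᗮ))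
  rw [← h, integrable_map_measure (by fun_prop) (by fun_prop)] at h1
  exact h1

lemma integral_norm_sq_starProjection (V : Submodule ℝ E) :
    ∫ z, ‖V.starProjection z‖ ^ 2 ∂(stdGaussian E) = Module.finrank ℝ V := by
  have h := map_norm_sq_starProjection_stdGaussian V
  have h1 : ∫ p : ℝ × ℝ, p.1 ∂((chiSq (Module.finrank ℝ V)).prod (chiSq (Module.finrank ℝ Vᗮ)))
      = Module.finrank ℝ V := by
    rw [integral_fun_fst (fun a : ℝ => a), integral_id_chiSq]
    simp
  rw [← h, integral_map (by fun_prop) (by fun_prop)] at h1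
  exact h1

lemma integrable_norm_sq_stdGaussian :
    Integrable (fun z => ‖z‖ ^ 2) (stdGaussian E) := by
  simpa [Submodule.starProjection_top'] using integrable_norm_sq_starProjection (⊤ : Submodule ℝ E)

lemma integral_norm_sq_stdGaussian :
    ∫ z, ‖z‖ ^ 2 ∂(stdGaussian E) = Module.finrank ℝ E := by
  simpa [Submodule.starProjection_top'] using integral_norm_sq_starProjection (⊤ : Submodule ℝ E)

end ChiSquare

/-! ### The function `dkhi` and its inverse -/

section Dkhi

lemma integrable_sub_mul_chiSq (D N : ℕ) (u : ℝ) :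
    Integrable (fun p : ℝ × ℝ => p.1 - u * (p.2 / (N : ℝ))) ((chiSq D).prod (chiSq N)) :=
  ((integrable_id_chiSq D).comp_fst _).sub
    ((((integrable_id_chiSq N).comp_snd _).div_const _).const_mul _)

lemma integrable_max_sub_mul_chiSq (D N : ℕ) (u : ℝ) :
    Integrable (fun p : ℝ × ℝ => max (p.1 - u * (p.2 / (N : ℝ))) 0)
      ((chiSq D).prod (chiSq N)) :=
  (integrable_sub_mul_chiSq D N u).pos_part

lemma integral_max_sub_mul_chiSq {D : ℕ} (hD : D ≠ 0) (N : ℕ) (u : ℝ) :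
    ∫ p, max (p.1 - u * (p.2 / (N : ℝ))) 0 ∂((chiSq D).prod (chiSq N)) = D * dkhi D N u := by
  have : (D : ℝ) ≠ 0 := by exact_mod_cast hD
  rw [dkhi, integral_id_chiSq]
  field_simp

lemma dkhi_zero {D : ℕ} (hD : D ≠ 0) (N : ℕ) : dkhi D N 0 = 1 := by
  have h0 : (D : ℝ) ≠ 0 := by exact_mod_cast hD
  have h : ∫ p, max (p.1 - 0 * (p.2 / (N : ℝ))) 0 ∂((chiSq D).prod (chiSq N))
      = ∫ p, p.1 ∂((chiSq D).prod (chiSq N)) := by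
    refine integral_congr_ae ?_
    filter_upwards [Measure.quasiMeasurePreserving_fst.ae (ae_nonneg_chiSq D)] with p hp
    simpa using hp
  rw [dkhi, h, integral_fun_fst (fun a : ℝ => a), integral_id_chiSq]
  simp [h0]

/-- The positive part is 1-Lipschitz and `X_N / N` has mean one. This serves to get continuity for
the intermediate value theorem. -/
lemma lipschitz_dkhi {D : ℕ} (hD : D ≠ 0) {N : ℕ} (hN : N ≠ 0) (u v : ℝ) :
    |dkhi D N u - dkhi D N v| ≤ (D : ℝ)⁻¹ * |u - v| := by
  have h0 : (N : ℝ) ≠ 0 := by exact_mod_cast hN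
  rw [dkhi, dkhi, integral_id_chiSq, ← mul_sub, ← integral_sub (integrable_max_sub_mul_chiSq D N u)
    (integrable_max_sub_mul_chiSq D N v), abs_mul, one_div,
    abs_of_nonneg (by positivity : 0 ≤ (D : ℝ)⁻¹)]
  refine mul_le_mul_of_nonneg_left ?_ (by positivity)
  have hI : (∫ p : ℝ × ℝ, |u - v| * (p.2 / (N : ℝ)) ∂((chiSq D).prod (chiSq N))) = |u - v| := by
    rw [integral_const_mul, integral_div, integral_fun_snd (fun a : ℝ => a), integral_id_chiSq]
    simp [h0]
  rw [← hI]
  refine (abs_integral_le_integral_abs).trans (integral_mono_ae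
    ((integrable_max_sub_mul_chiSq D N u).sub (integrable_max_sub_mul_chiSq D N v)).abs
    ((((integrable_id_chiSq N).comp_snd _).div_const _).const_mul _) ?_)
  filter_upwards [Measure.quasiMeasurePreserving_snd.ae (ae_nonneg_chiSq N)] with p hp
  refine (abs_max_sub_max_le_abs _ _ _).trans (le_of_eq ?_)
  rw [show p.1 - u * (p.2 / (N : ℝ)) - (p.1 - v * (p.2 / (N : ℝ)))
    = -((u - v) * (p.2 / (N : ℝ))) by ring, abs_neg, abs_mul, abs_of_nonneg (by positivity :
      0 ≤ p.2 / (N : ℝ))]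

lemma continuous_dkhi {D : ℕ} (hD : D ≠ 0) {N : ℕ} (hN : N ≠ 0) : Continuous (dkhi D N) := by
  refine (LipschitzWith.of_dist_le_mul (K := ⟨(D : ℝ)⁻¹, by positivity⟩) fun u v => ?_).continuous
  rw [Real.dist_eq, Real.dist_eq]
  exact lipschitz_dkhi hD hN u v

lemma dkhi_nonneg (D N : ℕ) (u : ℝ) : 0 ≤ dkhi D N u := by
  rw [dkhi, integral_id_chiSq]
  have : 0 ≤ ∫ p, max (p.1 - u * (p.2 / (N : ℝ))) 0 ∂((chiSq D).prod (chiSq N)) :=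
    integral_nonneg fun _ => le_max_right _ _
  positivity

/-- Chernoff bound for `dkhi`. -/
lemma mul_dkhi_le {D : ℕ} (hD : D ≠ 0) {N : ℕ} (hN : N ≠ 0) {u : ℝ} (hu : 0 ≤ u) :
    D * dkhi D N u ≤ 4 * (√2 ^ D * (√(1 + u / (2 * N)))⁻¹ ^ N) := by
  have h0 : (0 : ℝ) < N := by exact_mod_cast hN.bot_lt
  have hs : -(u / (4 * N)) < 1 / 2 := by
    have : 0 ≤ u / (4 * N) := by positivity
    linarith
  have h4 : (1 / 4 : ℝ) < 1 / 2 := by norm_num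
  rw [← integral_max_sub_mul_chiSq hD]
  -- From `1 + y ≤ exp y` with `y = x / 4`, the positive part of `x` is at most `4 exp (x / 4)`. The
  -- exponent `1/4 < 1/2` keeps the moment generating function of `X_D` finite, with a factor `√2`
  -- per degree of freedom.
  calc _ ≤ ∫ p : ℝ × ℝ, 4 * (Real.exp (1 / 4 * p.1) * Real.exp (-(u / (4 * N)) * p.2))
        ∂((chiSq D).prod (chiSq N)) := by
        refine integral_mono (integrable_max_sub_mul_chiSq D N u)
          (((integrable_exp_mul_chiSq D h4).mul_prod
            (integrable_exp_mul_chiSq N hs)).const_mul 4) fun p => ?_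
        simp only
        rw [← Real.exp_add, show 1 / 4 * p.1 + -(u / (4 * N)) * p.2
          = (p.1 - u * (p.2 / N)) / 4 by field_simp; ring]
        refine max_le ?_ (by positivity)
        have := Real.add_one_le_exp ((p.1 - u * (p.2 / N)) / 4)
        linarith
    _ = _ := by
        rw [integral_const_mul, integral_prod_mul (fun a : ℝ => Real.exp (1 / 4 * a))
          (fun b : ℝ => Real.exp (-(u / (4 * N)) * b)), integral_exp_mul_chiSq _ h4,
          integral_exp_mul_chiSq _ hs]
        congr 3
        · rw [← Real.sqrt_inv]
          norm_num
        · congr 3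
          field_simp
          ring

lemma exists_dkhi_le {D : ℕ} (hD : D ≠ 0) {N : ℕ} (hN : N ≠ 0) {q : ℝ} (hq : 0 < q) :
    ∃ u, 0 ≤ u ∧ dkhi D N u ≤ q := by
  have h0 : (0 : ℝ) < N := by exact_mod_cast hN.bot_lt
  have h1 : (1 : ℝ) ≤ D := by exact_mod_cast Nat.one_le_iff_ne_zero.2 hD
  have ht : Filter.Tendsto (fun u : ℝ => 4 * (√2 ^ D * (√(1 + u / (2 * N)))⁻¹ ^ N))
      Filter.atTop (nhds (4 * (√2 ^ D * 0 ^ N))) := by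
    refine ((Filter.Tendsto.pow ?_ N).const_mul _).const_mul _
    refine Filter.Tendsto.inv_tendsto_atTop ?_
    refine Real.tendsto_sqrt_atTop.comp ?_
    exact Filter.tendsto_atTop_add_const_left _ _
      (Filter.Tendsto.atTop_div_const (by positivity) Filter.tendsto_id)
  rw [zero_pow hN, mul_zero, mul_zero] at ht
  obtain ⟨u, hu, hu0⟩ := ((ht.eventually (gt_mem_nhds hq)).and
    (Filter.eventually_ge_atTop 0)).exists
  refine ⟨u, hu0, ?_⟩
  have := mul_dkhi_le hD hN hu0
  nlinarith [dkhi_nonneg D N u]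

lemma exists_dkhi_eq {D : ℕ} (hD : D ≠ 0) {N : ℕ} (hN : N ≠ 0) {q u : ℝ} (hq : q ≤ 1)
    (hu : 0 ≤ u) (h : dkhi D N u ≤ q) : ∃ v ∈ Set.Icc 0 u, dkhi D N v = q :=
  intermediate_value_Icc' hu (continuous_dkhi hD hN).continuousOn
    ⟨h, by rwa [dkhi_zero hD]⟩

/-- The solution set is closed, nonempty and bounded below, so its infimum is a solution; uniqueness
is not needed. -/
lemma edkhi_mem {D : ℕ} (hD : D ≠ 0) {N : ℕ} (hN : N ≠ 0) {q : ℝ} (hq : 0 < q) (hq1 : q ≤ 1) :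
    edkhi D N q ∈ {u | 0 ≤ u ∧ dkhi D N u = q} := by
  refine IsClosed.csInf_mem (s := {u | 0 ≤ u ∧ dkhi D N u = q})
    (isClosed_Ici.inter (isClosed_eq (continuous_dkhi hD hN) continuous_const)) ?_
    ⟨0, fun u hu => hu.1⟩
  obtain ⟨u, hu, h⟩ := exists_dkhi_le hD hN hq
  obtain ⟨v, hv, hvq⟩ := exists_dkhi_eq hD hN hq1 hu h
  exact ⟨v, hv.1, hvq⟩

/-- Continuity and `dkhi D N 0 = 1` give a solution in `[0, u]`, and `edkhi` is the infimum of all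
solutions; no monotonicity is involved. -/
lemma edkhi_le {D : ℕ} (hD : D ≠ 0) {N : ℕ} (hN : N ≠ 0) {q u : ℝ} (hq : q ≤ 1)
    (hu : 0 ≤ u) (h : dkhi D N u ≤ q) : edkhi D N q ≤ u := by
  obtain ⟨v, hv, hvq⟩ := exists_dkhi_eq hD hN hq hu h
  exact (csInf_le (s := {u | 0 ≤ u ∧ dkhi D N u = q}) ⟨0, fun u hu => hu.1⟩ ⟨hv.1, hvq⟩).trans hv.2

/-- If `D ≤ L + 1` and `L ≤ 2 N`, then `edkhi D N (exp (-L))` is at most of order `L`. -/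
lemma edkhi_exp_neg_le {D N L : ℕ} (hD : D ≠ 0) (hL : 1 ≤ L) (hDL : D ≤ L + 1) (hN : L ≤ 2 * N) :
    edkhi D N (Real.exp (-(L : ℝ))) ≤ 48 ^ 4 * L := by
  have hN0 : N ≠ 0 := by omega
  have h0 : (0 : ℝ) < N := by exact_mod_cast hN0.bot_lt
  have hL0 : (1 : ℝ) ≤ L := by exact_mod_cast hL
  have h1 : (1 : ℝ) ≤ D := by exact_mod_cast Nat.one_le_iff_ne_zero.2 hD
  have hNL : (L : ℝ) ≤ 2 * N := by exact_mod_cast hN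
  refine edkhi_le hD hN0 (Real.exp_le_one_iff.2 (by linarith)) (by positivity) ?_
  have hb := mul_dkhi_le hD hN0 (u := 48 ^ 4 * L) (by positivity)
  -- Bernoulli's inequality with exponent `2 N / L`, which is at least one by `hN`; the result is
  -- then raised to the power `L / 4`.
  have hbern : (48 : ℝ) ^ L ≤ √(1 + 48 ^ 4 * L / (2 * N)) ^ N := by
    have hx : (1 : ℝ) + 48 ^ 4 ≤ (1 + 48 ^ 4 * L / (2 * N)) ^ (2 * N / L : ℝ) := by
      refine le_trans (le_of_eq ?_) (one_add_mul_self_le_rpow_one_add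
        (s := 48 ^ 4 * L / (2 * N)) (le_trans (by norm_num) (by positivity : (0 : ℝ) ≤ _))
        (p := 2 * N / L) ((one_le_div (by linarith)).2 hNL))
      field_simp
    have hB : (0 : ℝ) ≤ 1 + 48 ^ 4 * L / (2 * N) := by positivity
    rw [Real.sqrt_eq_rpow, ← Real.rpow_natCast, ← Real.rpow_natCast, ← Real.rpow_mul hB,
      show (1 / 2 * N : ℝ) = (2 * N / L) * (L / 4) by field_simp; ring, Real.rpow_mul hB]
    calc (48 : ℝ) ^ (L : ℝ) = ((48 : ℝ) ^ (4 : ℕ)) ^ (L / 4 : ℝ) := by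
          rw [← Real.rpow_natCast, ← Real.rpow_mul (by norm_num)]
          congr 1
          push_cast
          ring
      _ ≤ _ := by
          refine Real.rpow_le_rpow (by norm_num) ?_ (by positivity)
          linarith
  have hs2 : √2 ^ D ≤ 2 * 2 ^ L := by
    have h2 : √2 ≤ 2 := Real.sqrt_le_left (by norm_num) |>.2 (by norm_num)
    have h3 : 1 ≤ √2 := Real.one_le_sqrt.2 (by norm_num)
    calc √2 ^ D ≤ √2 ^ (L + 1) := pow_le_pow_right₀ h3 hDL
      _ ≤ 2 ^ (L + 1) := by gcongr
      _ = _ := by ring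
  have hinv : (√(1 + 48 ^ 4 * L / (2 * N)))⁻¹ ^ N ≤ (48 ^ L)⁻¹ := by
    rw [inv_pow]
    exact inv_anti₀ (by positivity) hbern
  -- Here `48 = 8 * 2 * 3`: the `8` absorbs the prefactor `4 * 2` since `L ≥ 1`, the `2` absorbs `√2
  -- ^ D`, and the `3` dominates `e`.
  have he : (4 : ℝ) * (2 * 2 ^ L) * (48 ^ L)⁻¹ ≤ Real.exp (-(L : ℝ)) := by
    have hexp : Real.exp (L : ℝ) ≤ 3 ^ L := by
      rw [← Real.exp_one_pow]
      gcongr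
      exact Real.exp_one_lt_d9.le.trans (by norm_num)
    have h8 : (8 : ℝ) ≤ 8 ^ L := by simpa using pow_le_pow_right₀ (by norm_num : (1 : ℝ) ≤ 8) hL
    rw [Real.exp_neg, ← div_eq_mul_inv, div_le_iff₀ (by positivity), ← div_eq_inv_mul,
      le_div_iff₀ (Real.exp_pos _)]
    calc (4 : ℝ) * (2 * 2 ^ L) * Real.exp L = 8 * (2 ^ L * Real.exp L) := by ring
      _ ≤ 8 ^ L * (2 ^ L * 3 ^ L) := by gcongr
      _ = 48 ^ L := by rw [← mul_pow, ← mul_pow]; norm_num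
  have h2 := mul_le_mul hs2 hinv (by positivity) (by positivity)
  have h3 : dkhi D N (48 ^ 4 * L) ≤ D * dkhi D N (48 ^ 4 * L) :=
    le_mul_of_one_le_left (dkhi_nonneg _ _ _) h1
  refine h3.trans (hb.trans ((mul_le_mul_of_nonneg_left h2 (by norm_num)).trans ?_))
  rwa [← mul_assoc]

end Dkhi

/-! ### Cells and dimension of the models -/

section Cells

variable {d : ℕ}

lemma exists_mem_cell {k : Fin d → ℕ} (hk : ∀ i, 1 ≤ k i) {t : Fin d → ℝ} (ht : t ∈ unitCube d) :
    ∃ j, t ∈ cell k j := by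
  have h (i : Fin d) : ∃ j : Fin (k i), ((j : ℕ) : ℝ) / (k i : ℝ) ≤ t i ∧
      (t i < (((j : ℕ) : ℝ) + 1) / (k i : ℝ) ∨ ((j : ℕ) + 1 = k i ∧ t i = 1)) := by
    have hk0 : (0 : ℝ) < k i := by exact_mod_cast hk i
    obtain ⟨h0, h1⟩ := ht i
    rcases h1.lt_or_eq with h1 | h1
    · refine ⟨⟨⌊(k i : ℝ) * t i⌋₊, ?_⟩, ?_, Or.inl ?_⟩
      · rw [Nat.floor_lt (by positivity)]
        nlinarith
      · rw [div_le_iff₀ hk0, mul_comm (t i)]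
        exact Nat.floor_le (by positivity)
      · rw [lt_div_iff₀ hk0, mul_comm (t i)]
        exact Nat.lt_floor_add_one _
    · have : k i - 1 + 1 = k i := Nat.sub_add_cancel (hk i)
      refine ⟨⟨k i - 1, by omega⟩, ?_, Or.inr ⟨this, h1⟩⟩
      rw [h1, div_le_one hk0]
      exact_mod_cast Nat.sub_le _ _
  choose j hj using h
  exact ⟨j, hj⟩

lemma eval_eq_sum_of_mem_restrictDegree {r : ℕ} {p : MvPolynomial (Fin d) ℝ}
    (hp : p ∈ MvPolynomial.restrictDegree (Fin d) ℝ r) (t : Fin d → ℝ) :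
    MvPolynomial.eval t p = ∑ e : Fin d → Fin (r + 1),
      p.coeff (Finsupp.equivFunOnFinite.symm fun i => (e i : ℕ)) * ∏ i, t i ^ (e i : ℕ) := by
  rw [MvPolynomial.mem_restrictDegree] at hp
  rw [MvPolynomial.eval_eq']
  -- `Fin.ofNat` reduces modulo `r + 1`, which leaves the exponents of the support unchanged because
  -- they are at most `r`.
  refine Finset.sum_of_injOn (fun m i => Fin.ofNat (r + 1) (m i)) ?_ (by simp) ?_ ?_
  · intro m hm m' hm' h
    ext i
    have := congrArg Fin.val (congrFun h i)
    simpa [Nat.mod_eq_of_lt (Nat.lt_succ_of_le (hp m hm i)),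
      Nat.mod_eq_of_lt (Nat.lt_succ_of_le (hp m' hm' i))] using this
  · intro e _ he
    rw [MvPolynomial.notMem_support_iff.1, zero_mul]
    refine fun h => he ⟨_, h, ?_⟩
    ext i
    simp
  · intro m hm
    have h (i : Fin d) : m i % (r + 1) = m i := Nat.mod_eq_of_lt (Nat.lt_succ_of_le (hp m hm i))
    congr 1
    · congr 1
      ext i
      simp [h]
    · simp [h]

variable {n : ℕ} {x : Fin n → Fin d → ℝ}

/-- The model is spanned by the monomials cut off to single cells, one vector per cell and per
exponent. Fixing one cell `c i` for each design point makes disjointness of the cells unnecessary.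
-/
lemma modelDim_le_weight (hx : ∀ i, x i ∈ unitCube d) (m : ModelIndex d n) :
    modelDim x m ≤ weight m := by
  obtain ⟨⟨r, k⟩, hk, hm⟩ := m
  choose c hc using fun i => exists_mem_cell hk (hx i)
  set v : (∀ i, Fin (k i)) × (Fin d → Fin (r + 1)) → EuclideanSpace ℝ (Fin n) :=
    fun q => WithLp.toLp 2 fun i => if c i = q.1 then ∏ l, x i l ^ (q.2 l : ℕ) else 0 with hv
  have hle : model x ⟨⟨r, k⟩, hk, hm⟩ ≤ Submodule.span ℝ (Set.range v) := by
    rintro _ ⟨g, hg, rfl⟩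
    choose p hp hgp using hg
    have : evalAt x g = ∑ j, ∑ e : Fin d → Fin (r + 1),
        (p j).coeff (Finsupp.equivFunOnFinite.symm fun i => (e i : ℕ)) • v (j, e) := by
      ext i
      have h1 : evalAt x g i = g (x i) := rfl
      rw [h1, hgp _ _ (hc i), eval_eq_sum_of_mem_restrictDegree (hp _)]
      simp [hv]
    rw [this]
    exact Submodule.sum_mem _ fun j _ => Submodule.sum_mem _ fun e _ =>
      Submodule.smul_mem _ _ (Submodule.subset_span ⟨_, rfl⟩)
  calc modelDim x ⟨⟨r, k⟩, hk, hm⟩ ≤ Module.finrank ℝ (Submodule.span ℝ (Set.range v)) :=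
        Submodule.finrank_mono hle
    _ ≤ Fintype.card ((∀ i, Fin (k i)) × (Fin d → Fin (r + 1))) := finrank_range_le_card v
    _ = _ := by simp [weight, mul_comm]

lemma one_le_weight (m : ModelIndex d n) : 1 ≤ weight m :=
  Nat.mul_pos (by positivity) (Finset.prod_pos fun i _ => m.2.1 i)

lemma weight_add_two_le (m : ModelIndex d n) : weight m + 2 ≤ n := m.2.2

end Cells

/-! ### Summability of the weights -/

section Weights

variable {d n : ℕ}

/-- Without `d ≥ 1` the weight would not grow with the degree. This bound makes the family of models
finite and its weights summable uniformly in `n`. -/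
lemma index_le_weight (hd : 1 ≤ d) (m : ModelIndex d n) :
    (m.1.1 + 1) * ∏ i, m.1.2 i ≤ weight m :=
  Nat.mul_le_mul_right _ (Nat.le_self_pow (by omega) _)

/-- The indices of the models, as a finite set. -/
def indexFinset (d n : ℕ) : Finset (ℕ × (Fin d → ℕ)) :=
  Finset.range n ×ˢ Fintype.piFinset fun _ => Finset.Icc 1 n

lemma mem_indexFinset (hd : 1 ≤ d) (m : ModelIndex d n) : m.1 ∈ indexFinset d n := by
  have h := (index_le_weight hd m).trans_lt (by have := weight_add_two_le m; omega : weight m < n)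
  have hk := m.2.1
  have hp : 0 < ∏ i, m.1.2 i := Finset.prod_pos fun i _ => hk i
  simp only [indexFinset, Finset.mem_product, Finset.mem_range, Fintype.mem_piFinset,
    Finset.mem_Icc]
  refine ⟨by nlinarith, fun i => ⟨hk i, ?_⟩⟩
  have : m.1.2 i ≤ ∏ i, m.1.2 i :=
    Finset.single_le_prod' (f := m.1.2) (fun i _ => hk i) (Finset.mem_univ i)
  nlinarith

lemma finite_modelIndex (hd : 1 ≤ d) : Finite (ModelIndex d n) :=
  ((indexFinset d n).finite_toSet.subset fun m hm => mem_indexFinset hd ⟨m, hm⟩).to_subtype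

lemma add_one_mul_exp_neg_le {L : ℝ} (hL : 0 < L) : (L + 1) * Real.exp (-L) ≤ 24 * (L⁻¹) ^ 2 := by
  have h3 : L ^ 2 * (L + 1) ≤ 24 * Real.exp L := by
    have h3 := Real.pow_div_factorial_le_exp L hL.le 3
    have h2 := Real.pow_div_factorial_le_exp L hL.le 2
    norm_num [Nat.factorial] at h3 h2
    have := Real.exp_pos L
    nlinarith
  rw [Real.exp_neg, ← div_eq_mul_inv, inv_pow, ← div_eq_mul_inv,
    div_le_div_iff₀ (Real.exp_pos L) (by positivity)]
  linarith

lemma sum_Icc_inv_sq_le (n : ℕ) : ∑ k ∈ Finset.Icc 1 n, ((k : ℝ)⁻¹) ^ 2 ≤ 2 := by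
  have h := sum_Ioo_inv_sq_le (α := ℝ) 0 (n + 1)
  rw [show Finset.Ioo 0 (n + 1) = Finset.Icc 1 n by ext; simp; omega] at h
  simpa using h

/-- Trading exponential decay for inverse squares lets the sum factor into `d + 1` one-dimensional
sums, each at most `2`, so the bound is free of `n`. -/
lemma sum_weight_le (hd : 1 ≤ d) [Fintype (ModelIndex d n)] :
    ∑ m : ModelIndex d n, ((weight m : ℝ) + 1) * Real.exp (-(weight m : ℝ))
      ≤ 24 * 2 ^ (d + 1) := by
  set g : ℕ × (Fin d → ℕ) → ℝ := fun q => (((q.1 : ℝ) + 1)⁻¹) ^ 2 * ∏ i, ((q.2 i : ℝ)⁻¹) ^ 2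
    with hg
  have h1 (m : ModelIndex d n) :
      ((weight m : ℝ) + 1) * Real.exp (-(weight m : ℝ)) ≤ 24 * g m.1 := by
    have hw : (0 : ℝ) < weight m := by exact_mod_cast one_le_weight m
    refine (add_one_mul_exp_neg_le hw).trans ?_
    have hi : ((m.1.1 : ℝ) + 1) * ∏ i, (m.1.2 i : ℝ) ≤ weight m := by
      exact_mod_cast index_le_weight hd m
    have hpos : 0 < ((m.1.1 : ℝ) + 1) * ∏ i, (m.1.2 i : ℝ) :=
      mul_pos (by positivity) (Finset.prod_pos fun i _ => by exact_mod_cast m.2.1 i)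
    have h2 : g m.1 = ((((m.1.1 : ℝ) + 1) * ∏ i, (m.1.2 i : ℝ))⁻¹) ^ 2 := by
      simp only [hg]
      rw [mul_inv, mul_pow, ← Finset.prod_inv_distrib, Finset.prod_pow]
    rw [h2]
    gcongr
  calc _ ≤ ∑ m : ModelIndex d n, 24 * g m.1 := Finset.sum_le_sum fun m _ => h1 m
    _ = 24 * ∑ q ∈ Finset.univ.map (Function.Embedding.subtype _ : ModelIndex d n ↪ _), g q := by
        rw [Finset.sum_map, Finset.mul_sum]
        rfl
    _ ≤ 24 * ∑ q ∈ indexFinset d n, g q := by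
        refine mul_le_mul_of_nonneg_left (Finset.sum_le_sum_of_subset_of_nonneg (fun q hq => ?_)
          fun q _ _ => ?_) (by norm_num)
        · obtain ⟨m, -, rfl⟩ := Finset.mem_map.1 hq
          exact mem_indexFinset hd m
        · simp only [hg]
          positivity
    _ = 24 * ((∑ s ∈ Finset.range n, (((s : ℝ) + 1)⁻¹) ^ 2)
          * ∏ _i : Fin d, ∑ k ∈ Finset.Icc 1 n, ((k : ℝ)⁻¹) ^ 2) := by
        rw [indexFinset, Finset.sum_product, Finset.sum_mul, Finset.prod_univ_sum]
        simp only [hg, Finset.mul_sum]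
    _ ≤ 24 * (2 * ∏ _i : Fin d, 2) := by
        have h0 : 0 ≤ ∑ k ∈ Finset.Icc 1 n, ((k : ℝ)⁻¹) ^ 2 := by positivity
        have hs : ∑ s ∈ Finset.range n, (((s : ℝ) + 1)⁻¹) ^ 2 ≤ 2 := by
          refine le_trans (le_of_eq ?_) (sum_Icc_inv_sq_le n)
          rw [Finset.range_eq_Ico, ← Finset.Ico_add_one_right_eq_Icc,
            Finset.sum_Ico_add' (fun k : ℕ => ((k : ℝ)⁻¹) ^ 2) 0 n 1 |>.symm]
          simp
        have := sum_Icc_inv_sq_le n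
        gcongr
    _ = _ := by simp [pow_succ, mul_comm]

end Weights

/-! ### Risk of a least-squares estimator on a subspace -/

section Subspace

variable {E : Type*} [NormedAddCommGroup E] [InnerProductSpace ℝ E] [FiniteDimensional ℝ E]

/-- The dimension must be exactly one more, even if `μ ∈ S`, so that the degrees of freedom agree
with the arguments of `edkhi` in the penalty. -/
lemma exists_le_finrank_eq_add_one (S : Submodule ℝ E)
    (hS : Module.finrank ℝ S < Module.finrank ℝ E) (μ : E) :
    ∃ V : Submodule ℝ E, S ≤ V ∧ μ ∈ V ∧ Module.finrank ℝ V = Module.finrank ℝ S + 1 := by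
  have h (v : E) (hv : v ∉ S) : ∃ V : Submodule ℝ E, S ≤ V ∧ v ∈ V ∧
      Module.finrank ℝ V = Module.finrank ℝ S + 1 :=
    ⟨S ⊔ Submodule.span ℝ {v}, le_sup_left,
      (le_sup_right : _ ≤ S ⊔ Submodule.span ℝ {v}) (Submodule.mem_span_singleton_self v),
      Submodule.finrank_sup_span_singleton hv⟩
  by_cases hμ : μ ∈ S
  · obtain ⟨v, hv⟩ : ∃ v, v ∉ S := by
      by_contra! hall
      rw [(Submodule.eq_top_iff'.2 hall), finrank_top] at hS
      exact hS.false
    obtain ⟨V, hSV, -, hV⟩ := h v hv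
    exact ⟨V, hSV, hSV hμ, hV⟩
  · exact h μ hμ

lemma norm_sub_starProjection_le (S : Submodule ℝ E) (μ : E) {g : E} (hg : g ∈ S) :
    ‖μ - S.starProjection μ‖ ≤ ‖μ - g‖ := by
  rw [Submodule.starProjection_minimal]
  exact ciInf_le ⟨0, fun _ ⟨_, h⟩ => h ▸ norm_nonneg _⟩ (⟨g, hg⟩ : S)

/-- Pathwise control of the loss by the penalized residuals. -/
lemma loss_le_of_mem {S V : Submodule ℝ E} (hSV : S ≤ V) {μ : E} (hμ : μ ∈ V) {σ K p : ℝ}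
    (hσ : 0 ≤ σ) (hK : 0 < K) (hp : 0 ≤ p) (z : E) :
    (1 - 1 / K) * ‖μ - S.starProjection (μ + σ • z)‖ ^ 2
      ≤ ‖μ + σ • z - S.starProjection (μ + σ • z)‖ ^ 2 * (1 + p) - σ ^ 2 * ‖z‖ ^ 2
        + K * σ ^ 2 * (‖V.starProjection z‖ ^ 2 - p / K * ‖Vᗮ.starProjection z‖ ^ 2) := by
  set y := μ + σ • z with hy
  set w := μ - S.starProjection y with hw
  have hwV : w ∈ V := V.sub_mem hμ (hSV (S.starProjection_apply_mem y))
  have hyw : y - S.starProjection y = w + σ • z := by simp only [hy, hw]; abel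
  have hexp : ‖y - S.starProjection y‖ ^ 2
      = ‖w‖ ^ 2 + 2 * (σ * inner ℝ w z) + σ ^ 2 * ‖z‖ ^ 2 := by
    rw [hyw, norm_add_sq_real, inner_smul_right, norm_smul, mul_pow, Real.norm_eq_abs, sq_abs]
  have hin : inner ℝ w z = inner ℝ w (V.starProjection z) := by
    rw [← Submodule.inner_starProjection_left_eq_right, Submodule.starProjection_eq_self_iff.2 hwV]
  -- AM-GM with weight `1 / K`: the share of `‖w‖ ^ 2` lost here is what leaves `1 - 1 / K` in front
  -- of the loss.
  have hamgm : -(2 * (σ * inner ℝ w z)) ≤ 1 / K * ‖w‖ ^ 2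
      + K * σ ^ 2 * ‖V.starProjection z‖ ^ 2 := by
    have h1 : -inner ℝ w z ≤ ‖w‖ * ‖V.starProjection z‖ := by
      rw [hin]
      exact (neg_le_abs _).trans (abs_real_inner_le_norm _ _)
    have h2 : -(2 * (σ * inner ℝ w z)) ≤ 2 * (σ * (‖w‖ * ‖V.starProjection z‖)) := by
      nlinarith [mul_le_mul_of_nonneg_left h1 hσ]
    have h3 : 0 ≤ 1 / K * (‖w‖ - K * (σ * ‖V.starProjection z‖)) ^ 2 := by positivity
    have h4 : 1 / K * (‖w‖ - K * (σ * ‖V.starProjection z‖)) ^ 2 = 1 / K * ‖w‖ ^ 2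
      - 2 * (σ * (‖w‖ * ‖V.starProjection z‖)) + K * σ ^ 2 * ‖V.starProjection z‖ ^ 2 := by
      field_simp
      ring
    linarith
  -- Projecting the residual on `Vᗮ` kills `w` and leaves pure noise.
  have hres : σ ^ 2 * ‖Vᗮ.starProjection z‖ ^ 2 ≤ ‖y - S.starProjection y‖ ^ 2 := by
    have h1 : Vᗮ.starProjection (y - S.starProjection y) = σ • Vᗮ.starProjection z := by
      rw [hyw, map_add, map_smul, Submodule.starProjection_orthogonal_apply_eq_zero hwV, zero_add]
    have h2 := Vᗮ.norm_starProjection_apply_le (y - S.starProjection y)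
    rw [h1, norm_smul, Real.norm_of_nonneg hσ] at h2
    rw [← mul_pow]
    gcongr
  have hK1 : K * σ ^ 2 * (p / K * ‖Vᗮ.starProjection z‖ ^ 2)
      = p * (σ ^ 2 * ‖Vᗮ.starProjection z‖ ^ 2) := by
    field_simp
  have := mul_le_mul_of_nonneg_left hres hp
  rw [mul_sub, hK1]
  linarith

/-- The factor `1 + p` is split. In the unit part `σ² ‖z‖²` cancels exactly and leaves a centred
cross term; the part multiplied by `p` tolerates the crude factor `2`. -/
lemma residual_le (S : Submodule ℝ E) (μ : E) (σ : ℝ) {p : ℝ} (hp : 0 ≤ p) (z : E) :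
    ‖μ + σ • z - S.starProjection (μ + σ • z)‖ ^ 2 * (1 + p) - σ ^ 2 * ‖z‖ ^ 2
      ≤ ‖μ - S.starProjection μ‖ ^ 2 + 2 * (σ * inner ℝ (μ - S.starProjection μ) z)
        + p * (2 * ‖μ - S.starProjection μ‖ ^ 2 + 2 * σ ^ 2 * ‖z‖ ^ 2) := by
  set a := μ - S.starProjection μ with ha
  have h0 : μ + σ • z - S.starProjection (μ + σ • z) = Sᗮ.starProjection (a + σ • z) := by
    rw [Submodule.starProjection_orthogonal_val, ha, map_add, map_add, map_sub,
      Submodule.starProjection_eq_self_iff.2 (S.starProjection_apply_mem μ)]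
    abel
  have h1 : ‖μ + σ • z - S.starProjection (μ + σ • z)‖ ^ 2 ≤ ‖a + σ • z‖ ^ 2 := by
    rw [h0]
    gcongr
    exact Submodule.norm_starProjection_apply_le _ _
  have h2 : ‖a + σ • z‖ ^ 2 = ‖a‖ ^ 2 + 2 * (σ * inner ℝ a z) + σ ^ 2 * ‖z‖ ^ 2 := by
    rw [norm_add_sq_real, inner_smul_right, norm_smul, mul_pow, Real.norm_eq_abs, sq_abs]
  have h3 : ‖a + σ • z‖ ^ 2 ≤ 2 * ‖a‖ ^ 2 + 2 * σ ^ 2 * ‖z‖ ^ 2 := by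
    have h4 : ‖a - σ • z‖ ^ 2 = ‖a‖ ^ 2 - 2 * (σ * inner ℝ a z) + σ ^ 2 * ‖z‖ ^ 2 := by
      rw [norm_sub_sq_real, inner_smul_right, norm_smul, mul_pow, Real.norm_eq_abs, sq_abs]
    nlinarith [sq_nonneg ‖a - σ • z‖]
  have := mul_le_mul_of_nonneg_left (h1.trans h3) hp
  rw [h2] at h1
  linarith

variable [MeasurableSpace E] [BorelSpace E]

lemma integral_inner_stdGaussian (a : E) : ∫ z, inner ℝ a z ∂(stdGaussian E) = 0 :=
  integral_strongDual_stdGaussian (innerSL ℝ a)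

lemma integrable_inner_stdGaussian (a : E) : Integrable (fun z => inner ℝ a z) (stdGaussian E) :=
  IsGaussian.integrable_dual (stdGaussian E) (innerSL ℝ a)

lemma integrable_max_starProjection (V : Submodule ℝ E) (c : ℝ) :
    Integrable (fun z => max (‖V.starProjection z‖ ^ 2 - c * ‖Vᗮ.starProjection z‖ ^ 2) 0)
      (stdGaussian E) :=
  ((integrable_norm_sq_starProjection V).sub
    ((integrable_norm_sq_starProjection Vᗮ).const_mul c)).pos_part

lemma integral_max_starProjection {V : Submodule ℝ E} {D N : ℕ} (hD : D ≠ 0)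
    (hVD : Module.finrank ℝ V = D) (hVN : Module.finrank ℝ Vᗮ = N) (u : ℝ) :
    ∫ z, max (‖V.starProjection z‖ ^ 2 - u / N * ‖Vᗮ.starProjection z‖ ^ 2) 0 ∂(stdGaussian E)
      = D * dkhi D N u := by
  rw [← integral_max_sub_mul_chiSq hD, ← hVD, ← hVN, ← map_norm_sq_starProjection_stdGaussian,
    integral_map (by fun_prop) (by fun_prop)]
  congr 1
  ext z
  simp only
  congr 2
  ring

end Subspace

/-! ### Oracle inequality -/

section Oracle

variable {d n : ℕ} {x : Fin n → Fin d → ℝ}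

lemma modelCodim_add_modelDim (hx : ∀ i, x i ∈ unitCube d) (m : ModelIndex d n) :
    modelCodim x m + modelDim x m = n := by
  have := modelDim_le_weight hx m
  have := weight_add_two_le m
  unfold modelCodim
  omega

lemma two_le_modelCodim (hx : ∀ i, x i ∈ unitCube d) (m : ModelIndex d n) :
    2 ≤ modelCodim x m := by
  have := modelDim_le_weight hx m
  have := weight_add_two_le m
  unfold modelCodim
  omega

/-- The quantity `edkhi` entering the penalty. -/
noncomputable def penaltyQuantile (x : Fin n → Fin d → ℝ) (m : ModelIndex d n) : ℝ :=
  edkhi (modelDim x m + 1) (modelCodim x m - 1) (Real.exp (-(weight m : ℝ)))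

lemma penaltyQuantile_spec (hx : ∀ i, x i ∈ unitCube d) (m : ModelIndex d n) :
    0 ≤ penaltyQuantile x m ∧ dkhi (modelDim x m + 1) (modelCodim x m - 1) (penaltyQuantile x m)
      = Real.exp (-(weight m : ℝ)) := by
  have := two_le_modelCodim hx m
  exact edkhi_mem (by omega) (by omega) (Real.exp_pos _) (Real.exp_le_one_iff.2 (by simp))

/-- The factor `N_m / (N_m - 1)` in the penalty is there for this: the quantile ends up divided by
the dimension `N_m - 1` of `Vᗮ`, as in `dkhi`. -/
lemma penalty_div_modelCodim (hx : ∀ i, x i ∈ unitCube d) (K : ℝ) (m : ModelIndex d n) :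
    penalty K x m / (modelCodim x m : ℝ)
      = K * (penaltyQuantile x m / ((modelCodim x m - 1 : ℕ) : ℝ)) := by
  have h := two_le_modelCodim hx m
  have h2 : (2 : ℝ) ≤ modelCodim x m := by exact_mod_cast h
  have h3 : (modelCodim x m : ℝ) - 1 ≠ 0 := by linarith
  rw [penalty, ← penaltyQuantile, Nat.cast_sub (by omega), Nat.cast_one]
  field_simp

lemma measurable_leastSquares (m : ModelIndex d n) : Measurable (leastSquares x m) :=
  (model x m).starProjection.continuous.measurable

/-- When `2 L_m ≤ n`, the codimension minus one is at least `n / 4`, and `edkhi_exp_neg_le` applies.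
-/
lemma penalty_div_le (hx : ∀ i, x i ∈ unitCube d) {K : ℝ} (hK : 0 ≤ K) (m : ModelIndex d n)
    (hm : 2 * weight m ≤ n) :
    penalty K x m / (modelCodim x m : ℝ) * n ≤ K * (4 * 48 ^ 4) * weight m := by
  have h1 := modelCodim_add_modelDim hx m
  have h2 := modelDim_le_weight hx m
  have h3 := two_le_modelCodim hx m
  have hu : penaltyQuantile x m ≤ 48 ^ 4 * weight m :=
    edkhi_exp_neg_le (by omega) (one_le_weight m) (by omega) (by omega)
  rw [penalty_div_modelCodim hx]
  have hn : (n : ℝ) ≤ 4 * ((modelCodim x m - 1 : ℕ) : ℝ) := by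
    have : n ≤ 4 * (modelCodim x m - 1) := by omega
    exact_mod_cast this
  have hN : (0 : ℝ) < ((modelCodim x m - 1 : ℕ) : ℝ) := by
    have : 0 < modelCodim x m - 1 := by omega
    exact_mod_cast this
  have h0 := (penaltyQuantile_spec hx m).1
  rw [mul_assoc, mul_assoc]
  refine mul_le_mul_of_nonneg_left ?_ hK
  rw [div_mul_eq_mul_div, div_le_iff₀ hN]
  calc penaltyQuantile x m * n ≤ 48 ^ 4 * weight m * (4 * ((modelCodim x m - 1 : ℕ) : ℝ)) := by
        gcongr
    _ = _ := by ring

/-- The loss of the selected estimator, as a function of the noise. -/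
noncomputable def selectionLoss (x : Fin n → Fin d → ℝ) (mhat : EuclideanSpace ℝ (Fin n) → ModelIndex d n)
    (μ : EuclideanSpace ℝ (Fin n)) (σ : ℝ) (z : EuclideanSpace ℝ (Fin n)) : ℝ :=
  ‖μ - leastSquares x (mhat (μ + σ • z)) (μ + σ • z)‖ ^ 2

lemma measurable_selectionLoss {mhat : EuclideanSpace ℝ (Fin n) → ModelIndex d n}
    (hmhat : Measurable mhat) (μ : EuclideanSpace ℝ (Fin n)) (σ : ℝ) :
    Measurable (selectionLoss x mhat μ σ) := by
  have h1 : Measurable fun q : ModelIndex d n × EuclideanSpace ℝ (Fin n) =>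
      ‖μ - leastSquares x q.1 q.2‖ ^ 2 :=
    measurable_from_prod_countable_right fun m =>
      ((measurable_const.sub (measurable_leastSquares (x := x) m)).norm).pow_const 2
  have h2 : Measurable fun z : EuclideanSpace ℝ (Fin n) => μ + σ • z :=
    measurable_const.add (measurable_id.const_smul σ)
  have h3 : Measurable fun z : EuclideanSpace ℝ (Fin n) => (mhat (μ + σ • z), μ + σ • z) :=
    (hmhat.comp h2).prodMk h2
  unfold selectionLoss
  have h4 := h1.comp h3
  exact h4

lemma selectionLoss_nonneg (mhat : EuclideanSpace ℝ (Fin n) → ModelIndex d n)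
    (μ : EuclideanSpace ℝ (Fin n)) (σ : ℝ) (z : EuclideanSpace ℝ (Fin n)) :
    0 ≤ selectionLoss x mhat μ σ z :=
  sq_nonneg _

/-- Oracle inequality for the selected estimator. -/
theorem oracle_inequality (hd : 1 ≤ d) (hx : ∀ i, x i ∈ unitCube d) {K : ℝ} (hK : 1 < K)
    {σ : ℝ} (hσ : 0 < σ) (μ : EuclideanSpace ℝ (Fin n))
    {Ω : Type*} [MeasurableSpace Ω] {P : Measure Ω} [IsProbabilityMeasure P]
    {Z : Ω → EuclideanSpace ℝ (Fin n)}
    (hZ : HasLaw Z (stdGaussian (EuclideanSpace ℝ (Fin n))) P)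
    {mhat : EuclideanSpace ℝ (Fin n) → ModelIndex d n} (hmhat : Measurable mhat)
    (hmin : ∀ᵐ ω ∂P, ∀ m : ModelIndex d n,
      criterion K x (μ + σ • Z ω) (mhat (μ + σ • Z ω)) ≤ criterion K x (μ + σ • Z ω) m)
    (m : ModelIndex d n) :
    Integrable (fun ω => selectionLoss x mhat μ σ (Z ω)) P ∧
    (1 - 1 / K) * ∫ ω, selectionLoss x mhat μ σ (Z ω) ∂P
      ≤ ‖μ - leastSquares x m μ‖ ^ 2
        + penalty K x m / (modelCodim x m : ℝ)
          * (2 * ‖μ - leastSquares x m μ‖ ^ 2 + 2 * σ ^ 2 * n)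
        + K * σ ^ 2 * (24 * 2 ^ (d + 1)) := by
  have := finite_modelIndex (n := n) hd
  have := Fintype.ofFinite (ModelIndex d n)
  have hK0 : 0 < K := by linarith
  have hfr (m : ModelIndex d n) :
      Module.finrank ℝ (model x m) < Module.finrank ℝ (EuclideanSpace ℝ (Fin n)) := by
    have h1 := modelDim_le_weight hx m
    have h2 := weight_add_two_le m
    rw [modelDim] at h1
    rw [finrank_euclideanSpace_fin]
    omega
  -- The spaces depend on `m` and `μ` but not on the noise, so Cochran's theorem applies to each.
  choose V hSV hμV hVfr using fun m => exists_le_finrank_eq_add_one (model x m) (hfr m) μ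
  have hVD (m) : Module.finrank ℝ (V m) = modelDim x m + 1 := hVfr m
  have hVN (m) : Module.finrank ℝ (V m)ᗮ = modelCodim x m - 1 := by
    have h1 := Submodule.finrank_add_finrank_orthogonal (V m)
    rw [finrank_euclideanSpace_fin, hVD] at h1
    have := modelCodim_add_modelDim hx m
    omega
  set p : ModelIndex d n → ℝ := fun m => penalty K x m / (modelCodim x m : ℝ) with hpdef
  have hp (m) : 0 ≤ p m := by
    have := (penaltyQuantile_spec hx m).1
    simp only [hpdef, penalty_div_modelCodim hx]
    positivity
  have hpK (m) : p m / K = penaltyQuantile x m / ((modelCodim x m - 1 : ℕ) : ℝ) := by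
    simp only [hpdef, penalty_div_modelCodim hx]
    field_simp
  set T : ModelIndex d n → EuclideanSpace ℝ (Fin n) → ℝ := fun m z =>
    max (‖(V m).starProjection z‖ ^ 2 - p m / K * ‖(V m)ᗮ.starProjection z‖ ^ 2) 0 with hT
  have hTint (m) : Integrable (T m) (stdGaussian _) := integrable_max_starProjection _ _
  have hTval (m) : ∫ z, T m z ∂(stdGaussian _)
      ≤ ((weight m : ℝ) + 1) * Real.exp (-(weight m : ℝ)) := by
    simp only [hT, hpK]
    rw [integral_max_starProjection (by omega) (hVD m) (hVN m), (penaltyQuantile_spec hx m).2]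
    gcongr
    exact_mod_cast Nat.succ_le_succ (modelDim_le_weight hx m)
  set a := μ - leastSquares x m μ with ha
  set B : EuclideanSpace ℝ (Fin n) → ℝ := fun z =>
    ‖a‖ ^ 2 + 2 * (σ * inner ℝ a z) + p m * (2 * ‖a‖ ^ 2 + 2 * σ ^ 2 * ‖z‖ ^ 2)
      + K * σ ^ 2 * ∑ m, T m z with hB
  have hI1 : Integrable (fun z => 2 * (σ * inner ℝ a z)) (stdGaussian (EuclideanSpace ℝ (Fin n))) :=
    ((integrable_inner_stdGaussian a).const_mul σ).const_mul 2
  have hI2 : Integrable (fun z => 2 * σ ^ 2 * ‖z‖ ^ 2) (stdGaussian (EuclideanSpace ℝ (Fin n))) :=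
    integrable_norm_sq_stdGaussian.const_mul _
  have hI3 : Integrable (fun z => p m * (2 * ‖a‖ ^ 2 + 2 * σ ^ 2 * ‖z‖ ^ 2))
      (stdGaussian (EuclideanSpace ℝ (Fin n))) := ((integrable_const _).add hI2).const_mul _
  have hI4 : Integrable (fun z => K * σ ^ 2 * ∑ m, T m z)
      (stdGaussian (EuclideanSpace ℝ (Fin n))) :=
    (integrable_finsetSum _ fun m _ => hTint m).const_mul _
  have hI5 : Integrable (fun z => ‖a‖ ^ 2 + 2 * (σ * inner ℝ a z))
      (stdGaussian (EuclideanSpace ℝ (Fin n))) := (integrable_const _).add hI1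
  have hI6 : Integrable (fun z => ‖a‖ ^ 2 + 2 * (σ * inner ℝ a z)
      + p m * (2 * ‖a‖ ^ 2 + 2 * σ ^ 2 * ‖z‖ ^ 2))
      (stdGaussian (EuclideanSpace ℝ (Fin n))) := hI5.add hI3
  have hBint : Integrable B (stdGaussian _) := hI6.add hI4
  have hBval : ∫ z, B z ∂(stdGaussian _) ≤ ‖a‖ ^ 2
      + p m * (2 * ‖a‖ ^ 2 + 2 * σ ^ 2 * n) + K * σ ^ 2 * (24 * 2 ^ (d + 1)) := by
    simp only [hB]
    rw [integral_add hI6 hI4, integral_add hI5 hI3, integral_add (integrable_const _) hI1,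
      integral_const_mul, integral_const_mul, integral_const_mul, integral_const_mul,
      integral_add (integrable_const _) hI2, integral_const_mul, integral_const_mul, integral_inner_stdGaussian,
      integral_norm_sq_stdGaussian, integral_finsetSum _ fun m _ => hTint m]
    have : ∑ m, ∫ z, T m z ∂(stdGaussian _) ≤ 24 * 2 ^ (d + 1) :=
      (Finset.sum_le_sum fun m _ => hTval m).trans (sum_weight_le hd)
    simp only [integral_const, probReal_univ, smul_eq_mul, one_mul, mul_zero, add_zero,
      finrank_euclideanSpace_fin]
    gcongr
  have hpath : ∀ᵐ ω ∂P, (1 - 1 / K) * selectionLoss x mhat μ σ (Z ω) ≤ B (Z ω) := by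
    filter_upwards [hmin] with ω hω
    have h1 := hω m
    set mh := mhat (μ + σ • Z ω) with hmh
    have h2 := loss_le_of_mem (hSV mh) (hμV mh) hσ.le hK0 (hp mh) (Z ω)
    have h3 := residual_le (model x m) μ σ (hp m) (Z ω)
    -- The index `mh` is random, so its term is dominated by the sum of the positive parts over all
    -- models.
    have h4 : ‖(V mh).starProjection (Z ω)‖ ^ 2 - p mh / K * ‖(V mh)ᗮ.starProjection (Z ω)‖ ^ 2
        ≤ ∑ m, T m (Z ω) :=
      (le_max_left _ 0).trans (Finset.single_le_sum (f := fun m => T m (Z ω))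
        (fun m _ => le_max_right _ _) (Finset.mem_univ mh))
    have h5 := mul_le_mul_of_nonneg_left h4 (by positivity : 0 ≤ K * σ ^ 2)
    simp only [criterion] at h1
    simp only [selectionLoss, ← hmh, hB]
    simp only [leastSquares] at h1 ha ⊢
    simp only [ha]
    linarith
  have hc : 0 < 1 - 1 / K := by
    rw [sub_pos, div_lt_one hK0]
    exact hK
  have hBΩ : Integrable (fun ω => B (Z ω)) P :=
    Integrable.comp_aemeasurable (g := B) (by rwa [hZ.map_eq]) hZ.aemeasurable
  have hint : Integrable (fun ω => selectionLoss x mhat μ σ (Z ω)) P := by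
    refine Integrable.mono' (hBΩ.const_mul (1 - 1 / K)⁻¹)
      ((measurable_selectionLoss hmhat μ σ).comp_aemeasurable hZ.aemeasurable).aestronglyMeasurable
      ?_
    filter_upwards [hpath] with ω hω
    rw [Real.norm_of_nonneg (selectionLoss_nonneg _ _ _ _), ← div_eq_inv_mul, le_div_iff₀ hc, mul_comm]
    exact hω
  refine ⟨hint, ?_⟩
  rw [← integral_const_mul]
  refine (integral_mono_ae (hint.const_mul _) hBΩ hpath).trans (le_trans (le_of_eq ?_) hBval)
  exact hZ.integral_comp hBint.aestronglyMeasurable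

end Oracle

/-! ### One-dimensional interpolation -/

section OneDim

/-- `T` is the Taylor polynomial of order `q` at `a`. The remainder is an increment of the `q`-th
derivative times `(t - a) ^ q / q!`, and the increment is Hölder. -/
lemma exists_taylor_polynomial {q : ℕ} {g : ℝ → ℝ} {R β : ℝ} (hR : 0 ≤ R) (hβ : 0 < β)
    (hg : ContDiffOn ℝ q g (Set.Icc 0 1))
    (hH : ∀ s ∈ Set.Icc (0 : ℝ) 1, ∀ z ∈ Set.Icc (0 : ℝ) 1,
      |iteratedDerivWithin q g (Set.Icc 0 1) s - iteratedDerivWithin q g (Set.Icc 0 1) z|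
        ≤ R * |s - z| ^ β)
    {a h : ℝ} (ha : 0 ≤ a) (hah : a + h ≤ 1) :
    ∃ T : Polynomial ℝ, T.degree < ((q + 1 : ℕ) : WithBot ℕ) ∧
      ∀ t ∈ Set.Icc a (a + h), |g t - T.eval t| ≤ R * h ^ ((q : ℝ) + β) := by
  set c : ℕ → ℝ := fun k => iteratedDerivWithin k g (Set.Icc 0 1) a with hc
  refine ⟨∑ k ∈ Finset.range (q + 1), Polynomial.C ((k.factorial : ℝ)⁻¹ * c k) *
    (Polynomial.X - Polynomial.C a) ^ k, ?_, fun t ht => ?_⟩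
  · rw [← Polynomial.mem_degreeLT]
    refine Submodule.sum_mem _ fun k hk => ?_
    rw [← Polynomial.smul_eq_C_mul]
    refine Submodule.smul_mem _ _ (Polynomial.mem_degreeLT.2 ?_)
    rw [Polynomial.degree_pow, Polynomial.degree_X_sub_C, nsmul_one]
    exact_mod_cast Finset.mem_range.1 hk
  · have hh : 0 ≤ h := by linarith [ht.1, ht.2]
    have ha1 : a ∈ Set.Icc (0 : ℝ) 1 := ⟨ha, by linarith⟩
    have ht1 : t ∈ Set.Icc (0 : ℝ) 1 := ⟨ha.trans ht.1, ht.2.trans hah⟩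
    have hta : |t - a| ≤ h := by rw [abs_of_nonneg] <;> linarith [ht.1, ht.2]
    have heval : Polynomial.eval t (∑ k ∈ Finset.range (q + 1),
        Polynomial.C ((k.factorial : ℝ)⁻¹ * c k) * (Polynomial.X - Polynomial.C a) ^ k)
        = ∑ k ∈ Finset.range (q + 1), (k.factorial : ℝ)⁻¹ * c k * (t - a) ^ k := by
      simp [Polynomial.eval_finsetSum]
    rw [heval]
    have hpow : R * h ^ ((q : ℝ) + β) = R * h ^ β * h ^ q := by
      rcases hh.eq_or_lt with rfl | hh
      · rw [Real.zero_rpow (by positivity), Real.zero_rpow hβ.ne']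
        ring
      · rw [Real.rpow_add hh, Real.rpow_natCast]
        ring
    -- Lagrange's remainder for order `q - 1`, from which the term of degree `q` is subtracted. The
    -- cases `t = a` and `q = 0` are separate, as that theorem does not cover them.
    have key : ∃ x' ∈ Set.Icc a t, g t - ∑ k ∈ Finset.range (q + 1),
        (k.factorial : ℝ)⁻¹ * c k * (t - a) ^ k
        = (iteratedDerivWithin q g (Set.Icc 0 1) x' - c q) * ((t - a) ^ q / q.factorial) := by
      rcases ht.1.eq_or_lt with rfl | hat
      · refine ⟨a, ⟨le_rfl, le_rfl⟩, ?_⟩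
        rw [Finset.sum_range_succ']
        simp [hc]
      rcases q with _ | q
      · exact ⟨t, ⟨hat.le, le_rfl⟩, by simp [hc]⟩
      have hsub : Set.Icc a t ⊆ Set.Icc (0 : ℝ) 1 := Set.Icc_subset_Icc ha ht1.2
      have hu : UniqueDiffOn ℝ (Set.Icc a t) := uniqueDiffOn_Icc hat
      have hu1 : UniqueDiffOn ℝ (Set.Icc (0 : ℝ) 1) := uniqueDiffOn_Icc one_pos
      have hsame {k : ℕ} (hk : k ≤ q + 1) {s : ℝ} (hs : s ∈ Set.Icc a t) :
          iteratedDerivWithin k g (Set.Icc a t) s = iteratedDerivWithin k g (Set.Icc 0 1) s := by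
        rw [iteratedDerivWithin_eq_iteratedFDerivWithin, iteratedDerivWithin_eq_iteratedFDerivWithin,
          iteratedFDerivWithin_subset hsub hu hu1 (hg.of_le (by exact_mod_cast hk)) hs]
      have hgt : ContDiffOn ℝ (q + 1 : ℕ) g (Set.Icc a t) := hg.mono hsub
      have hd : DifferentiableOn ℝ (iteratedDerivWithin q g (Set.Icc a t)) (Set.Icc a t) :=
        hgt.differentiableOn_iteratedDerivWithin (by exact_mod_cast Nat.lt_succ_self q) hu
      obtain ⟨x', hx', h'⟩ := taylor_mean_remainder_lagrange (f := g) (n := q) hat.ne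
        (by rw [Set.uIcc_of_le hat.le]; exact hgt.of_le (by exact_mod_cast Nat.le_succ q))
        (by rw [Set.uIcc_of_le hat.le, Set.uIoo_of_lt hat]; exact hd.mono Set.Ioo_subset_Icc_self)
      rw [Set.uIoo_of_lt hat] at hx'
      have hx'' : x' ∈ Set.Icc a t := Set.Ioo_subset_Icc_self hx'
      refine ⟨x', hx'', ?_⟩
      rw [Set.uIcc_of_le hat.le, hsame le_rfl hx'', taylor_within_apply] at h'
      have hs : ∑ k ∈ Finset.range (q + 1), ((k.factorial : ℝ)⁻¹ * (t - a) ^ k) •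
          iteratedDerivWithin k g (Set.Icc a t) a
          = ∑ k ∈ Finset.range (q + 1), (k.factorial : ℝ)⁻¹ * c k * (t - a) ^ k := by
        refine Finset.sum_congr rfl fun k hk => ?_
        rw [hsame (by have := Finset.mem_range.1 hk; omega) ⟨le_rfl, hat.le⟩, smul_eq_mul]
        ring
      rw [hs] at h'
      rw [Finset.sum_range_succ, ← sub_sub, h']
      rw [Nat.factorial_succ]
      push_cast
      ring
    obtain ⟨x', hx', hkey⟩ := key
    have hx1 : x' ∈ Set.Icc (0 : ℝ) 1 := ⟨ha.trans hx'.1, hx'.2.trans ht1.2⟩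
    have hxa : |x' - a| ≤ h := by rw [abs_of_nonneg] <;> linarith [hx'.1, hx'.2, ht.2]
    rw [hkey, abs_mul, hpow]
    refine mul_le_mul ((hH x' hx1 a ha1).trans ?_) ?_ (abs_nonneg _) (by positivity)
    · gcongr
    · rw [abs_div, abs_pow, Nat.abs_cast]
      refine (div_le_self (by positivity) ?_).trans (by gcongr)
      exact_mod_cast q.factorial_pos

/-- Dividing by `q + 1` rather than `q` keeps the nodes `l ≤ q` strictly below `a + h`, hence inside
a half-open cell, and allows `q = 0`. -/
lemma injective_equispaced (q : ℕ) (a : ℝ) {h : ℝ} (hh : 0 < h) :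
    Function.Injective fun l : ℕ => a + h * (l / ((q : ℝ) + 1)) := by
  intro i j hij
  have h2 := mul_left_cancel₀ hh.ne' (add_left_cancel hij)
  rw [div_left_inj' (by positivity)] at h2
  exact_mod_cast h2

/-- Bound on the Lagrange basis polynomials at equispaced nodes. -/
lemma abs_eval_basis_le {q : ℕ} {a h : ℝ} (hh : 0 < h) {l : ℕ}
    {t : ℝ} (ht : t ∈ Set.Icc a (a + h)) :
    |(Lagrange.basis (Finset.range (q + 1)) (fun l : ℕ => a + h * (l / ((q : ℝ) + 1))) l).eval t|
      ≤ ((q : ℝ) + 1) ^ (q + 1) := by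
  rw [Lagrange.basis, Polynomial.eval_prod, Finset.abs_prod]
  have hcard : ((Finset.range (q + 1)).erase l).card ≤ q + 1 :=
    (Finset.card_le_card (Finset.erase_subset _ _)).trans (by simp)
  have h1 : (1 : ℝ) ≤ (q : ℝ) + 1 := by
    have : (0 : ℝ) ≤ q := by positivity
    linarith
  -- Each factor has numerator at most `h` and denominator at least the spacing `h / (q + 1)`.
  refine le_trans (Finset.prod_le_prod (fun _ _ => abs_nonneg _) fun j hj => ?_)
    ((Finset.prod_const ((q : ℝ) + 1)).le.trans (pow_le_pow_right₀ h1 hcard))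
  have hjl := Finset.ne_of_mem_erase hj
  have hjq : (j : ℝ) < (q : ℝ) + 1 := by
    exact_mod_cast Finset.mem_range.1 (Finset.mem_of_mem_erase hj)
  rw [Lagrange.basisDivisor, Polynomial.eval_mul, Polynomial.eval_C, Polynomial.eval_sub,
    Polynomial.eval_X, Polynomial.eval_C, abs_mul, abs_inv, ← div_eq_inv_mul]
  have hlj : 1 ≤ |(l : ℝ) - j| := by
    have : (1 : ℤ) ≤ |(l : ℤ) - j| := Int.one_le_abs (sub_ne_zero.2 (by exact_mod_cast hjl.symm))
    exact_mod_cast this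
  have hden : a + h * (l / ((q : ℝ) + 1)) - (a + h * (j / ((q : ℝ) + 1)))
      = h / ((q : ℝ) + 1) * (l - j) := by
    ring
  have hh2 : 0 < h / ((q : ℝ) + 1) := by positivity
  rw [hden, abs_mul, abs_of_pos hh2]
  have hnum : |t - (a + h * (j / ((q : ℝ) + 1)))| ≤ h := by
    have h2 : 0 ≤ h * (j / ((q : ℝ) + 1)) := by positivity
    have h3 : h * (j / ((q : ℝ) + 1)) ≤ h :=
      mul_le_of_le_one_right hh.le ((div_le_one (by linarith)).2 hjq.le)
    rw [abs_le]
    constructor <;> linarith [ht.1, ht.2]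
  rw [div_le_iff₀ (by positivity)]
  calc _ ≤ h := hnum
    _ = ((q : ℝ) + 1) * (h / ((q : ℝ) + 1) * 1) := by field_simp
    _ ≤ _ := by gcongr

/-- A common bound for the Lebesgue constants of the interpolation operators of degree at most
`r`. -/
def lebesgueBound (r : ℕ) : ℝ := ((r : ℝ) + 1) ^ (r + 2)

lemma one_le_lebesgueBound (r : ℕ) : 1 ≤ lebesgueBound r :=
  one_le_pow₀ (by linarith [(Nat.cast_nonneg r : (0 : ℝ) ≤ r)])

/-- There are `q + 1` nodes, each with a basis polynomial bounded by `(q + 1) ^ (q + 1)`; hence the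
exponent `r + 2` in `lebesgueBound`. -/
lemma abs_sum_mul_basis_le {q r : ℕ} (hqr : q ≤ r) {a h : ℝ} (hh : 0 < h)
    {t : ℝ} (ht : t ∈ Set.Icc a (a + h)) {y : ℕ → ℝ} {M : ℝ}
    (hy : ∀ l ∈ Finset.range (q + 1), |y l| ≤ M) :
    |∑ l ∈ Finset.range (q + 1), y l *
      (Lagrange.basis (Finset.range (q + 1)) (fun l : ℕ => a + h * (l / ((q : ℝ) + 1))) l).eval t|
      ≤ lebesgueBound r * M := by
  have hM : 0 ≤ M := (abs_nonneg _).trans (hy 0 (by simp))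
  have hqr' : (q : ℝ) + 1 ≤ (r : ℝ) + 1 := by
    have : (q : ℝ) ≤ r := by exact_mod_cast hqr
    linarith
  have h1 : (1 : ℝ) ≤ (r : ℝ) + 1 := by
    have : (0 : ℝ) ≤ r := by positivity
    linarith
  calc _ ≤ ∑ l ∈ Finset.range (q + 1), M * ((q : ℝ) + 1) ^ (q + 1) := by
        refine (Finset.abs_sum_le_sum_abs _ _).trans (Finset.sum_le_sum fun l hl => ?_)
        rw [abs_mul]
        exact mul_le_mul (hy l hl) (abs_eval_basis_le hh ht) (abs_nonneg _) hM
    _ = ((q : ℝ) + 1) ^ (q + 2) * M := by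
        rw [Finset.sum_const, Finset.card_range, nsmul_eq_mul]
        push_cast
        ring
    _ ≤ ((r : ℝ) + 1) ^ (r + 2) * M := by
        gcongr
        exact (pow_le_pow_left₀ (by positivity) hqr' _).trans
          (pow_le_pow_right₀ h1 (by omega))

/-- Interpolation reproduces the Taylor polynomial `T`, so the error is `g - T` minus the
interpolant of `g - T`. -/
lemma abs_sub_interpolation_le {q r : ℕ} (hqr : q ≤ r) {g : ℝ → ℝ} {R β : ℝ} (hR : 0 ≤ R)
    (hβ : 0 < β) (hg : ContDiffOn ℝ q g (Set.Icc 0 1))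
    (hH : ∀ s ∈ Set.Icc (0 : ℝ) 1, ∀ z ∈ Set.Icc (0 : ℝ) 1,
      |iteratedDerivWithin q g (Set.Icc 0 1) s - iteratedDerivWithin q g (Set.Icc 0 1) z|
        ≤ R * |s - z| ^ β)
    {a h : ℝ} (hh : 0 < h) (ha : 0 ≤ a) (hah : a + h ≤ 1) {t : ℝ} (ht : t ∈ Set.Icc a (a + h)) :
    |g t - ∑ l ∈ Finset.range (q + 1), g (a + h * (l / ((q : ℝ) + 1))) *
      (Lagrange.basis (Finset.range (q + 1)) (fun l : ℕ => a + h * (l / ((q : ℝ) + 1))) l).eval t|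
      ≤ (1 + lebesgueBound r) * (R * h ^ ((q : ℝ) + β)) := by
  obtain ⟨T, hT, hgT⟩ := exists_taylor_polynomial hR hβ hg hH ha hah
  set v : ℕ → ℝ := fun l => a + h * (l / ((q : ℝ) + 1)) with hv
  have hinj : Set.InjOn v (Finset.range (q + 1)) := (injective_equispaced q a hh).injOn
  have hvI {l : ℕ} (hl : l ∈ Finset.range (q + 1)) : v l ∈ Set.Icc a (a + h) := by
    have hl' : (l : ℝ) ≤ (q : ℝ) + 1 := by exact_mod_cast (Finset.mem_range.1 hl).le
    have h2 : 0 ≤ h * (l / ((q : ℝ) + 1)) := by positivity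
    have h3 : h * (l / ((q : ℝ) + 1)) ≤ h :=
      mul_le_of_le_one_right hh.le ((div_le_one (by positivity)).2 hl')
    constructor <;> simp only [hv] <;> linarith
  have hTi : T.eval t = ∑ l ∈ Finset.range (q + 1), T.eval (v l) *
      (Lagrange.basis (Finset.range (q + 1)) v l).eval t := by
    conv_lhs => rw [Lagrange.eq_interpolate hinj (f := T) (by simpa using hT)]
    rw [Lagrange.interpolate_apply, Polynomial.eval_finsetSum]
    simp
  have hsplit : g t - ∑ l ∈ Finset.range (q + 1), g (v l) *
      (Lagrange.basis (Finset.range (q + 1)) v l).eval t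
      = (g t - T.eval t) - ∑ l ∈ Finset.range (q + 1), (g (v l) - T.eval (v l)) *
        (Lagrange.basis (Finset.range (q + 1)) v l).eval t := by
    simp only [sub_mul, Finset.sum_sub_distrib, ← hTi]
    ring
  rw [hsplit, add_mul, one_mul]
  exact (abs_sub _ _).trans (add_le_add (hgT t ht)
    (abs_sum_mul_basis_le hqr hh ht fun l hl => hgT _ (hvI hl)))

end OneDim

/-! ### Approximation of Hölderian functions by piecewise polynomials -/

section Approximation

/-- The left end point of the interval of length `1 / k` containing `s`. -/
noncomputable def leftEnd (k : ℕ) (s : ℝ) : ℝ := ((min ⌊(k : ℝ) * s⌋₊ (k - 1) : ℕ) : ℝ) / k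

lemma leftEnd_nonneg (k : ℕ) (s : ℝ) : 0 ≤ leftEnd k s := by
  unfold leftEnd
  positivity

lemma leftEnd_add_le {k : ℕ} (hk : 1 ≤ k) (s : ℝ) : leftEnd k s + 1 / k ≤ 1 := by
  have hk0 : (0 : ℝ) < k := by exact_mod_cast hk
  rw [leftEnd, ← add_div, div_le_one hk0]
  have : min ⌊(k : ℝ) * s⌋₊ (k - 1) + 1 ≤ k := by omega
  exact_mod_cast this

lemma mem_Icc_leftEnd {k : ℕ} (hk : 1 ≤ k) {s : ℝ} (hs : s ∈ Set.Icc (0 : ℝ) 1) :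
    s ∈ Set.Icc (leftEnd k s) (leftEnd k s + 1 / k) := by
  have hk0 : (0 : ℝ) < k := by exact_mod_cast hk
  have hks : 0 ≤ (k : ℝ) * s := mul_nonneg hk0.le hs.1
  constructor
  · rw [leftEnd, div_le_iff₀ hk0, mul_comm s]
    exact le_trans (by exact_mod_cast min_le_left _ _) (Nat.floor_le hks)
  · rw [leftEnd, ← add_div, le_div_iff₀ hk0, mul_comm s]
    rcases min_choice ⌊(k : ℝ) * s⌋₊ (k - 1) with h | h <;> rw [h]
    · exact (Nat.lt_floor_add_one _).le
    · rw [Nat.cast_sub hk, Nat.cast_one, sub_add_cancel]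
      exact mul_le_of_le_one_right hk0.le hs.2

variable {d : ℕ}

/-- The interpolation nodes thus depend on the cell only; the minimum in `leftEnd` sends the end
point `1` to the last cell. -/
lemma leftEnd_of_mem_cell {k : Fin d → ℕ} {j : ∀ i, Fin (k i)} {t : Fin d → ℝ}
    (ht : t ∈ cell k j) (i : Fin d) : leftEnd (k i) (t i) = ((j i : ℕ) : ℝ) / k i := by
  have hk0 : (0 : ℝ) < k i := by exact_mod_cast (j i).pos
  have hj := (j i).isLt
  obtain ⟨h1, h2⟩ := ht i
  rw [div_le_iff₀ hk0, mul_comm] at h1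
  have h3 : (j i : ℕ) ≤ ⌊(k i : ℝ) * t i⌋₊ := Nat.le_floor h1
  rw [leftEnd]
  congr 2
  rcases h2 with h2 | ⟨h2, h4⟩
  · rw [lt_div_iff₀ hk0, mul_comm] at h2
    have h5 : ⌊(k i : ℝ) * t i⌋₊ < (j i : ℕ) + 1 := by
      rw [Nat.floor_lt (by nlinarith [(Nat.cast_nonneg (j i : ℕ) : (0 : ℝ) ≤ (j i : ℕ))])]
      exact_mod_cast h2
    omega
  · omega

/-- The interpolation node with index `l` of degree `q` in the interval containing `s`. -/
noncomputable def node (k q : ℕ) (s : ℝ) (l : ℕ) : ℝ :=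
  leftEnd k s + 1 / (k : ℝ) * (l / ((q : ℝ) + 1))

lemma node_mem_Ico {k q : ℕ} (hk : 1 ≤ k) (s : ℝ) {l : ℕ} (hl : l ∈ Finset.range (q + 1)) :
    node k q s l ∈ Set.Ico (leftEnd k s) (leftEnd k s + 1 / k) := by
  have hk0 : (0 : ℝ) < 1 / k := by
    have : (0 : ℝ) < k := by exact_mod_cast hk
    positivity
  have hl' : (l : ℝ) < (q : ℝ) + 1 := by exact_mod_cast Finset.mem_range.1 hl
  have h2 : 0 ≤ 1 / (k : ℝ) * (l / ((q : ℝ) + 1)) := by positivity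
  have h3 : 1 / (k : ℝ) * (l / ((q : ℝ) + 1)) < 1 / k :=
    mul_lt_of_lt_one_right hk0 ((div_lt_one (by positivity)).2 hl')
  constructor <;> unfold node <;> linarith

lemma node_mem_Icc {k q : ℕ} (hk : 1 ≤ k) (s : ℝ) {l : ℕ} (hl : l ∈ Finset.range (q + 1)) :
    node k q s l ∈ Set.Icc (0 : ℝ) 1 :=
  ⟨(leftEnd_nonneg k s).trans (node_mem_Ico hk s hl).1,
    (node_mem_Ico hk s hl).2.le.trans (leftEnd_add_le hk s)⟩

/-- Piecewise Lagrange interpolation of degree `q` in the `i`-th coordinate, on the regular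
partition of `[0, 1]` into `k` intervals. -/
noncomputable def interp (k q : ℕ) (i : Fin d) (g : (Fin d → ℝ) → ℝ) (t : Fin d → ℝ) : ℝ :=
  ∑ l ∈ Finset.range (q + 1), g (Function.update t i (node k q (t i) l)) *
    (Lagrange.basis (Finset.range (q + 1)) (node k q (t i)) l).eval (t i)

lemma update_mem_unitCube {t : Fin d → ℝ} (ht : t ∈ unitCube d) (i : Fin d) {s : ℝ}
    (hs : s ∈ Set.Icc (0 : ℝ) 1) : Function.update t i s ∈ unitCube d := by
  intro m
  by_cases h : m = i
  · subst h
    simpa using hs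
  · simpa [h] using ht m

lemma update_mem_cell {k : Fin d → ℕ} {j : ∀ i, Fin (k i)} {t : Fin d → ℝ} (ht : t ∈ cell k j)
    (i : Fin d) {s : ℝ} (hs : s ∈ Set.Ico (((j i : ℕ) : ℝ) / k i) (((j i : ℕ) : ℝ) / k i + 1 / k i)) :
    Function.update t i s ∈ cell k j := by
  intro m
  by_cases h : m = i
  · subst h
    rw [← add_div] at hs
    simpa using ⟨hs.1, Or.inl hs.2⟩
  · simpa [h] using ht m

lemma abs_interp_sub_le {k q r : ℕ} (hk : 1 ≤ k) (hqr : q ≤ r) (i : Fin d)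
    {f g : (Fin d → ℝ) → ℝ} {M : ℝ} (h : ∀ t ∈ unitCube d, |f t - g t| ≤ M) {t : Fin d → ℝ}
    (ht : t ∈ unitCube d) : |interp k q i f t - interp k q i g t| ≤ lebesgueBound r * M := by
  have hk0 : (0 : ℝ) < k := by exact_mod_cast hk
  rw [interp, interp, ← Finset.sum_sub_distrib]
  simp only [← sub_mul]
  exact abs_sum_mul_basis_le (h := 1 / (k : ℝ)) hqr (by positivity) (mem_Icc_leftEnd hk (ht i))
    fun l hl => h _ (update_mem_unitCube ht i (node_mem_Icc hk _ hl))

lemma holderExponent_pos {a : ℝ} (ha : 0 < a) : 0 < holderExponent a := by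
  have h1 : 0 < ⌈a⌉₊ := Nat.ceil_pos.2 ha
  have h2 := Nat.ceil_lt_add_one ha.le
  rw [holderExponent, holderOrder, Nat.cast_sub h1, Nat.cast_one]
  linarith

lemma le_holderOrder_add_one {a : ℝ} : a ≤ holderOrder a + 1 := by
  have h2 := Nat.le_ceil a
  have h3 : ⌈a⌉₊ ≤ holderOrder a + 1 := by unfold holderOrder; omega
  exact h2.trans (by exact_mod_cast h3)

lemma abs_sub_interp_le {α R : Fin d → ℝ} {f : (Fin d → ℝ) → ℝ} (hf : f ∈ holderClass α R)
    {k r : ℕ} (hk : 1 ≤ k) (i : Fin d) (hα : 0 < α i) (hR : 0 ≤ R i)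
    (hr : holderOrder (α i) ≤ r) {t : Fin d → ℝ} (ht : t ∈ unitCube d) :
    |f t - interp k (holderOrder (α i)) i f t|
      ≤ (1 + lebesgueBound r) * (R i * (1 / (k : ℝ)) ^ α i) := by
  have hk0 : (0 : ℝ) < k := by exact_mod_cast hk
  obtain ⟨h1, h2⟩ := hf i t ht
  have h := abs_sub_interpolation_le hr hR (holderExponent_pos hα) h1 h2
    (h := 1 / (k : ℝ)) (by positivity) (leftEnd_nonneg k (t i)) (leftEnd_add_le hk _)
    (mem_Icc_leftEnd hk (ht i))
  have h3 : slice f t i (t i) = f t := by simp [slice]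
  rw [h3, holderExponent, add_sub_cancel] at h
  exact h

/-- On each cell, `g` is a polynomial of degree at most `r` in each of the coordinates in `A`,
with coefficients depending on the other coordinates only. -/
def IsCellPolynomial (r : ℕ) (k : Fin d → ℕ) (A : Finset (Fin d)) (g : (Fin d → ℝ) → ℝ) : Prop :=
  ∀ j : (∀ i, Fin (k i)), ∃ (ι : Type) (_ : Fintype ι) (e : ι → Fin d → ℕ)
    (c : ι → (Fin d → ℝ) → ℝ), (∀ ν i, e ν i ≤ r) ∧
    (∀ ν t t', (∀ i, i ∉ A → t i = t' i) → c ν t = c ν t') ∧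
    ∀ t ∈ cell k j, g t = ∑ ν, c ν t * ∏ i ∈ A, t i ^ e ν i

lemma isCellPolynomial_empty (r : ℕ) (k : Fin d → ℕ) (g : (Fin d → ℝ) → ℝ) :
    IsCellPolynomial r k ∅ g := fun _ =>
  ⟨Unit, inferInstance, fun _ _ => 0, fun _ => g, fun _ _ => Nat.zero_le _,
    fun _ t t' h => by rw [funext fun i => h i (Finset.notMem_empty i)], fun t _ => by simp⟩

/-- Interpolating in `t i` freezes that coordinate at nodes of the same cell, where the expansion of
`g` is still valid, and puts the dependence on `t i` into Lagrange polynomials of degree at most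
`r`. -/
lemma IsCellPolynomial.interp {r : ℕ} {k : Fin d → ℕ} (hk : ∀ i, 1 ≤ k i) {A : Finset (Fin d)}
    {g : (Fin d → ℝ) → ℝ} (hg : IsCellPolynomial r k A g) {i : Fin d} (hi : i ∉ A) {q : ℕ}
    (hq : q ≤ r) : IsCellPolynomial r k (insert i A) (interp (k i) q i g) := by
  intro j
  obtain ⟨ι, _, e, c, he, hc, hgc⟩ := hg j
  set x : ℕ → ℝ := fun l => ((j i : ℕ) : ℝ) / k i + 1 / (k i : ℝ) * (l / ((q : ℝ) + 1)) with hx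
  set b : ℕ → Polynomial ℝ := fun l => Lagrange.basis (Finset.range (q + 1)) x l with hb
  have hbdeg {l : ℕ} (hl : l ∈ Finset.range (q + 1)) : (b l).natDegree < r + 1 := by
    have hk0 : (0 : ℝ) < k i := by exact_mod_cast hk i
    simp only [hb]
    rw [Lagrange.natDegree_basis
      (injective_equispaced q _ (by positivity : 0 < 1 / (k i : ℝ))).injOn hl]
    simp
    omega
  refine ⟨ι × Fin (r + 1), inferInstance, fun ν => Function.update (e ν.1) i ν.2,
    fun ν t => ∑ l ∈ Finset.range (q + 1), c ν.1 (Function.update t i (x l)) * (b l).coeff ν.2,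
    fun ν m => ?_, fun ν t t' h => ?_, fun t ht => ?_⟩
  · by_cases h : m = i
    · subst h
      simpa using Nat.le_of_lt_succ ν.2.isLt
    · simpa [h] using he ν.1 m
  · refine Finset.sum_congr rfl fun l _ => ?_
    rw [hc ν.1 (Function.update t i (x l)) (Function.update t' i (x l)) fun m hm => ?_]
    by_cases hmi : m = i
    · subst hmi
      simp
    · simpa [hmi] using h m (by simp [hmi, hm])
  · have hnode : node (k i) q (t i) = x := by
      ext l
      simp only [node, leftEnd_of_mem_cell ht, hx]
    have hprod (s : ℝ) (ν : ι) : ∏ m ∈ A, (Function.update t i s) m ^ e ν m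
        = ∏ m ∈ A, t m ^ e ν m := by
      refine Finset.prod_congr rfl fun m hm => ?_
      rw [Function.update_of_ne (ne_of_mem_of_not_mem hm hi)]
    have hprod' (ν : ι) (a : Fin (r + 1)) :
        ∏ m ∈ insert i A, t m ^ (Function.update (e ν) i a) m
        = t i ^ (a : ℕ) * ∏ m ∈ A, t m ^ e ν m := by
      rw [Finset.prod_insert hi, Function.update_self]
      congr 1
      refine Finset.prod_congr rfl fun m hm => ?_
      rw [Function.update_of_ne (ne_of_mem_of_not_mem hm hi)]
    have hterm {l : ℕ} (hl : l ∈ Finset.range (q + 1)) :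
        g (Function.update t i (x l)) * (b l).eval (t i)
        = ∑ ν : ι, ∑ a : Fin (r + 1), c ν (Function.update t i (x l)) * (b l).coeff a
          * (t i ^ (a : ℕ) * ∏ m ∈ A, t m ^ e ν m) := by
      have hxl : x l ∈ Set.Ico (((j i : ℕ) : ℝ) / k i) (((j i : ℕ) : ℝ) / k i + 1 / k i) := by
        have := node_mem_Ico (hk i) (t i) hl
        rwa [hnode, leftEnd_of_mem_cell ht] at this
      rw [hgc _ (update_mem_cell ht i hxl), Polynomial.eval_eq_sum_range' (hbdeg hl),
        ← Fin.sum_univ_eq_sum_range (fun a => (b l).coeff a * t i ^ a), Finset.sum_mul_sum]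
      refine Finset.sum_congr rfl fun ν _ => Finset.sum_congr rfl fun a _ => ?_
      rw [hprod]
      ring
    rw [SignalEstimation.interp, hnode, Finset.sum_congr rfl fun l hl => hterm hl,
      Finset.sum_comm, Fintype.sum_prod_type]
    refine Finset.sum_congr rfl fun ν _ => ?_
    rw [Finset.sum_comm]
    refine Finset.sum_congr rfl fun a _ => ?_
    rw [hprod', Finset.sum_mul]

lemma IsCellPolynomial.mem_piecewisePolynomials {r : ℕ} {k : Fin d → ℕ} {g : (Fin d → ℝ) → ℝ}
    (hg : IsCellPolynomial r k Finset.univ g) : g ∈ piecewisePolynomials r k := by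
  intro j
  obtain ⟨ι, _, e, c, he, hc, hgc⟩ := hg j
  refine ⟨∑ ν, MvPolynomial.monomial (Finsupp.equivFunOnFinite.symm (e ν)) (c ν 0),
    Submodule.sum_mem _ fun ν _ => ?_, fun t ht => ?_⟩
  · rw [MvPolynomial.mem_restrictDegree]
    intro s hs i
    have := MvPolynomial.support_monomial_subset hs
    rw [Finset.mem_singleton] at this
    rw [this]
    exact he ν i
  · rw [hgc t ht, map_sum]
    refine Finset.sum_congr rfl fun ν _ => ?_
    -- No coordinate lies outside `Finset.univ`, so the coefficients are constant and may be read
    -- off at `0`.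
    rw [hc ν t 0 (by simp), MvPolynomial.eval_monomial, Finsupp.prod_fintype _ _ (by simp)]
    rfl

/-- Anisotropic approximation by piecewise polynomials. -/
theorem exists_piecewisePolynomial_approx {α R : Fin d → ℝ} {f : (Fin d → ℝ) → ℝ}
    (hf : f ∈ holderClass α R) (hα : ∀ i, 0 < α i) (hR : ∀ i, 0 ≤ R i) {r : ℕ}
    (hr : ∀ i, holderOrder (α i) ≤ r) {k : Fin d → ℕ} (hk : ∀ i, 1 ≤ k i) :
    ∃ g ∈ piecewisePolynomials r k, ∀ t ∈ unitCube d, |f t - g t|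
      ≤ lebesgueBound r ^ d * ∑ i, (1 + lebesgueBound r) * (R i * (1 / (k i : ℝ)) ^ α i) := by
  have hL := one_le_lebesgueBound r
  -- Induction on the set of interpolated coordinates: `f - I g = (f - I f) + (I f - I g)`, where
  -- the first term is the one-dimensional error in the new direction and the second is the previous
  -- error times the Lebesgue bound.
  have key (A : Finset (Fin d)) : ∃ g, IsCellPolynomial r k A g ∧ ∀ t ∈ unitCube d, |f t - g t|
      ≤ lebesgueBound r ^ A.card
        * ∑ i ∈ A, (1 + lebesgueBound r) * (R i * (1 / (k i : ℝ)) ^ α i) := by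
    induction A using Finset.induction with
    | empty => exact ⟨f, isCellPolynomial_empty r k f, by simp⟩
    | insert i A hi ih =>
      obtain ⟨g, hg, hfg⟩ := ih
      refine ⟨_, hg.interp hk hi (hr i), fun t ht => ?_⟩
      have h1 := abs_sub_interp_le hf (hk i) i (hα i) (hR i) (hr i) ht
      have h2 := abs_interp_sub_le (hk i) (hr i) i hfg ht
      have h3 := (abs_sub_le _ _ _).trans (add_le_add h1 h2)
      refine h3.trans ?_
      rw [Finset.card_insert_of_notMem hi, Finset.sum_insert hi, mul_add, pow_succ']
      rw [mul_assoc (lebesgueBound r)]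
      have h4 : 1 ≤ lebesgueBound r ^ A.card := one_le_pow₀ hL
      have h5 : 1 ≤ lebesgueBound r * lebesgueBound r ^ A.card := one_le_mul_of_one_le_of_one_le hL h4
      have h6 : 0 ≤ (1 + lebesgueBound r) * (R i * (1 / (k i : ℝ)) ^ α i) := by
        have := hR i
        positivity
      nlinarith
  obtain ⟨g, hg, hfg⟩ := key Finset.univ
  exact ⟨g, hg.mem_piecewisePolynomials, by simpa using hfg⟩

end Approximation

/-! ### Choice of the partition -/

section Scale

variable {d : ℕ} {α R : Fin d → ℝ}

lemma meanSmoothness_pos (hd : 1 ≤ d) (hα : ∀ i, 0 < α i) : 0 < meanSmoothness α := by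
  have : Nonempty (Fin d) := ⟨⟨0, hd⟩⟩
  have h0 : (0 : ℝ) < d := by exact_mod_cast hd
  have h1 : 0 < ∑ i, 1 / α i :=
    Finset.sum_pos (fun i _ => one_div_pos.2 (hα i)) Finset.univ_nonempty
  unfold meanSmoothness
  positivity

lemma sum_inv_eq (hd : 1 ≤ d) : ∑ i, 1 / α i = d / meanSmoothness α := by
  have h0 : (d : ℝ) ≠ 0 := by
    have : d ≠ 0 := by omega
    exact_mod_cast this
  rw [meanSmoothness, div_inv_eq_mul, ← mul_assoc, mul_one_div_cancel h0, one_mul]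

lemma meanSmoothness_le (hd : 1 ≤ d) (hα : ∀ i, 0 < α i) {r : ℕ}
    (hr : ∀ i, holderOrder (α i) ≤ r) : meanSmoothness α ≤ r + 1 := by
  have h0 : (0 : ℝ) < d := by exact_mod_cast hd
  have ha := meanSmoothness_pos hd hα
  have h1 : (d : ℝ) * (1 / ((r : ℝ) + 1)) ≤ ∑ i, 1 / α i := by
    have : ∑ _i : Fin d, 1 / ((r : ℝ) + 1) ≤ ∑ i, 1 / α i := by
      refine Finset.sum_le_sum fun i _ => one_div_le_one_div_of_le (hα i) ?_
      have : (holderOrder (α i) : ℝ) ≤ r := by exact_mod_cast hr i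
      linarith [le_holderOrder_add_one (a := α i)]
    simpa using this
  rw [sum_inv_eq hd, mul_one_div, div_le_div_iff_of_pos_left h0 (by positivity) ha] at h1
  exact h1

lemma meanRadius_pos (hR : ∀ i, 0 < R i) : 0 < meanRadius α R :=
  Real.rpow_pos_of_pos (Finset.prod_pos fun i _ => Real.rpow_pos_of_pos (hR i) _) _

/-- The left side is the ideal number of cells at accuracy `η`; the mean radius and mean smoothness
are the combinations through which it depends on `α` and `R`. -/
lemma prod_rpow_one_div (hd : 1 ≤ d) (hα : ∀ i, 0 < α i) (hR : ∀ i, 0 < R i) {η : ℝ}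
    (hη : 0 < η) :
    ∏ i, (R i / η) ^ (1 / α i) = (meanRadius α R / η) ^ ((d : ℝ) / meanSmoothness α) := by
  have h0 : (d : ℝ) ≠ 0 := by
    have : d ≠ 0 := by omega
    exact_mod_cast this
  have ha := meanSmoothness_pos hd hα
  have hprod : 0 ≤ ∏ i, R i ^ (meanSmoothness α / α i) :=
    Finset.prod_nonneg fun i _ => (Real.rpow_pos_of_pos (hR i) _).le
  have h1 : meanRadius α R ^ ((d : ℝ) / meanSmoothness α) = ∏ i, R i ^ (1 / α i) := by
    rw [meanRadius, ← Real.rpow_mul hprod, ← Real.finsetProd_rpow _ _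
      fun i _ => (Real.rpow_pos_of_pos (hR i) _).le]
    refine Finset.prod_congr rfl fun i _ => ?_
    rw [← Real.rpow_mul (hR i).le]
    congr 1
    field_simp
  rw [Real.div_rpow (meanRadius_pos hR).le hη.le, h1, ← sum_inv_eq hd,
    Real.rpow_sum_of_pos hη, ← Finset.prod_div_distrib]
  exact Finset.prod_congr rfl fun i _ => Real.div_rpow (hR i).le hη.le _

/-- The accuracy balancing bias and variance, limited by the number of observations. -/
lemma exists_accuracy (hd : 1 ≤ d) {r n : ℕ} (hn : 1 ≤ n) {σ : ℝ} (hσ : 0 < σ)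
    (hα : ∀ i, 0 < α i) (hR : ∀ i, 0 < R i) (hr : ∀ i, holderOrder (α i) ≤ r)
    (h1 : ∀ i, meanRadius α R ^ (d : ℝ) * σ ^ (2 * meanSmoothness α)
        ≤ (n : ℝ) ^ meanSmoothness α * R i ^ (2 * meanSmoothness α + d))
    (h2 : ∀ i, (2 : ℝ) ^ meanSmoothness α * meanRadius α R ^ (d : ℝ)
          * ((r : ℝ) + 1) ^ (d * meanSmoothness α)
        ≤ (n : ℝ) ^ meanSmoothness α * R i ^ (d : ℝ)) :
    ∃ η : ℝ, 0 < η ∧ (∀ i, η ≤ R i) ∧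
      (meanRadius α R / η) ^ ((d : ℝ) / meanSmoothness α) ≤ n / (2 * ((r : ℝ) + 1) ^ d) ∧
      (meanRadius α R / η) ^ ((d : ℝ) / meanSmoothness α) * σ ^ 2 / n ≤ η ^ 2 ∧
      η ^ 2 ≤ (2 * ((r : ℝ) + 1) ^ d) ^ (2 * (r + 1)) * max
              ((meanRadius α R ^ ((d : ℝ) / meanSmoothness α) * σ ^ 2 / (n : ℝ))
                ^ (2 * meanSmoothness α / (2 * meanSmoothness α + d)))
              (meanRadius α R ^ 2 / (n : ℝ) ^ (2 * meanSmoothness α / d)) := by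
  have ha := meanSmoothness_pos hd hα
  have har := meanSmoothness_le hd hα hr
  have hρ := meanRadius_pos (α := α) hR
  set a := meanSmoothness α
  set ρ := meanRadius α R
  have hd0 : (0 : ℝ) < d := by exact_mod_cast hd
  have hd1 : (1 : ℝ) ≤ d := by exact_mod_cast hd
  have hn0 : (0 : ℝ) < n := by exact_mod_cast hn
  set v := ρ ^ ((d : ℝ) / a) * σ ^ 2 / (n : ℝ) with hv
  have hv0 : 0 < v := by positivity
  set b := 2 * ((r : ℝ) + 1) ^ d with hb
  have hb1 : 1 ≤ b := by
    have : (1 : ℝ) ≤ ((r : ℝ) + 1) ^ d := one_le_pow₀ (by linarith [(Nat.cast_nonneg r : (0 : ℝ) ≤ r)])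
    linarith
  have hb0 : 0 < b := by linarith
  -- `η₁` solves `(ρ / η) ^ (d / a) * σ ^ 2 / n = η ^ 2`, and `η₂` solves `(ρ / η) ^ (d / a) = n /
  -- b`.
  set η₁ := v ^ (a / (2 * a + d)) with hη₁
  set η₂ := ρ * (b / n) ^ (a / d) with hη₂
  have hη₁0 : 0 < η₁ := Real.rpow_pos_of_pos hv0 _
  have hη₂0 : 0 < η₂ := mul_pos hρ (Real.rpow_pos_of_pos (by positivity) _)
  have hη₁sq : η₁ ^ 2 = v ^ (2 * a / (2 * a + d)) := by
    rw [hη₁, ← Real.rpow_natCast, ← Real.rpow_mul hv0.le]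
    congr 1
    push_cast
    ring
  have hda : 0 ≤ (d : ℝ) / a := by positivity
  -- The hypotheses `h1` and `h2` say exactly that `η₁ ≤ R i` and `η₂ ≤ R i`.
  refine ⟨max η₁ η₂, lt_max_of_lt_left hη₁0, fun i => max_le ?_ ?_, ?_, ?_, ?_⟩
  · rw [← Real.rpow_le_rpow_iff hη₁0.le (hR i).le (by positivity : 0 < 2 * a + d), hη₁,
      ← Real.rpow_mul hv0.le, div_mul_cancel₀ _ (by positivity : 2 * a + (d : ℝ) ≠ 0), hv,
      Real.div_rpow (by positivity) hn0.le, Real.mul_rpow (by positivity) (by positivity),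
      ← Real.rpow_mul hρ.le, div_mul_cancel₀ _ ha.ne', div_le_iff₀ (by positivity),
      ← Real.rpow_natCast σ, ← Real.rpow_mul hσ.le, mul_comm (R i ^ _)]
    exact_mod_cast h1 i
  · rw [← Real.rpow_le_rpow_iff hη₂0.le (hR i).le hd0, hη₂, Real.mul_rpow hρ.le (by positivity),
      ← Real.rpow_mul (by positivity), div_mul_cancel₀ _ hd0.ne', Real.div_rpow hb0.le hn0.le,
      ← mul_div_assoc, div_le_iff₀ (by positivity), hb, Real.mul_rpow (by norm_num) (by positivity),
      ← Real.rpow_natCast (_ + 1 : ℝ), ← Real.rpow_mul (by positivity), mul_comm (R i ^ _)]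
    refine le_trans (le_of_eq ?_) (h2 i)
    ring
  · calc (ρ / max η₁ η₂) ^ ((d : ℝ) / a) ≤ (ρ / η₂) ^ ((d : ℝ) / a) := by
          refine Real.rpow_le_rpow (by positivity) ?_ hda
          exact div_le_div_of_nonneg_left hρ.le hη₂0 (le_max_right _ _)
      _ = n / b := by
          have : ρ / η₂ = (n / b) ^ (a / d) := by
            rw [hη₂, div_mul_cancel_left₀ hρ.ne', ← Real.inv_rpow (by positivity), inv_div]
          rw [this, ← Real.rpow_mul (by positivity), div_mul_div_cancel₀ hd0.ne', div_self ha.ne',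
            Real.rpow_one]
  · have hle : (ρ / max η₁ η₂) ^ ((d : ℝ) / a) ≤ (ρ / η₁) ^ ((d : ℝ) / a) := by
      refine Real.rpow_le_rpow (by positivity) ?_ hda
      exact div_le_div_of_nonneg_left hρ.le hη₁0 (le_max_left _ _)
    calc (ρ / max η₁ η₂) ^ ((d : ℝ) / a) * σ ^ 2 / n
        ≤ (ρ / η₁) ^ ((d : ℝ) / a) * σ ^ 2 / n := by gcongr
      _ = v / η₁ ^ ((d : ℝ) / a) := by
          rw [Real.div_rpow hρ.le hη₁0.le, hv]
          ring
      _ = η₁ ^ 2 := by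
          rw [hη₁sq, hη₁, ← Real.rpow_mul hv0.le]
          nth_rw 1 [← Real.rpow_one v]
          rw [← Real.rpow_sub hv0]
          congr 1
          field_simp
          ring
      _ ≤ max η₁ η₂ ^ 2 := by
          gcongr
          exact le_max_left _ _
  · have hc : 1 ≤ b ^ (2 * (r + 1)) := one_le_pow₀ hb1
    -- The factor `b ^ (2 * a / d)` depends on the smoothness; `a ≤ r + 1` and `d ≥ 1` replace its
    -- exponent by `2 * (r + 1)`.
    have hη₂sq : η₂ ^ 2 ≤ b ^ (2 * (r + 1)) * (ρ ^ 2 / (n : ℝ) ^ (2 * a / d)) := by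
      have : η₂ ^ 2 = b ^ (2 * a / d) * (ρ ^ 2 / (n : ℝ) ^ (2 * a / d)) := by
        rw [hη₂, mul_pow, ← Real.rpow_natCast ((b / n) ^ (a / d)), ← Real.rpow_mul (by positivity),
          show a / d * ((2 : ℕ) : ℝ) = 2 * a / d by push_cast; ring,
          Real.div_rpow hb0.le hn0.le]
        ring
      rw [this]
      refine mul_le_mul_of_nonneg_right ?_ (by positivity)
      rw [← Real.rpow_natCast b]
      refine Real.rpow_le_rpow_of_exponent_le hb1 ?_
      push_cast
      exact (div_le_self (by positivity) hd1).trans (by linarith)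
    rcases max_choice η₁ η₂ with h | h <;> rw [h]
    · rw [hη₁sq]
      refine (le_max_left _ _).trans (le_mul_of_one_le_left ?_ hc)
      exact (Real.rpow_pos_of_pos hv0 _).le.trans (le_max_left _ _)
    · refine hη₂sq.trans (mul_le_mul_of_nonneg_left (le_max_right _ _) (by linarith))

/-- The anisotropic partition adapted to the accuracy `η`. -/
lemma exists_partition {r : ℕ} (hα : ∀ i, 0 < α i) (hR : ∀ i, 0 < R i)
    (hr : ∀ i, holderOrder (α i) ≤ r) {η : ℝ} (hη : 0 < η) (hηR : ∀ i, η ≤ R i) :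
    ∃ k : Fin d → ℕ, (∀ i, 1 ≤ k i) ∧ (∏ i, (k i : ℝ) ≤ ∏ i, (R i / η) ^ (1 / α i)) ∧
      ∀ i, R i * (1 / (k i : ℝ)) ^ α i ≤ 2 ^ (r + 1) * η := by
  have hx (i) : 1 ≤ (R i / η) ^ (1 / α i) :=
    Real.one_le_rpow ((one_le_div hη).2 (hηR i)) (one_div_pos.2 (hα i)).le
  have hk (i) : 1 ≤ ⌊(R i / η) ^ (1 / α i)⌋₊ := Nat.one_le_floor_iff _ |>.2 (hx i)
  refine ⟨fun i => ⌊(R i / η) ^ (1 / α i)⌋₊, hk, ?_, fun i => ?_⟩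
  · exact Finset.prod_le_prod (fun i _ => by positivity)
      fun i _ => Nat.floor_le (zero_le_one.trans (hx i))
  · have hk1 : (1 : ℝ) ≤ ⌊(R i / η) ^ (1 / α i)⌋₊ := by exact_mod_cast hk i
    have hx2 := Nat.lt_floor_add_one ((R i / η) ^ (1 / α i))
    have hRη : 0 < R i / η := div_pos (hR i) hη
    -- A number that is at least one is at most twice its floor, so rounding costs `2 ^ α i`.
    have h1 : 1 / (⌊(R i / η) ^ (1 / α i)⌋₊ : ℝ) ≤ 2 / (R i / η) ^ (1 / α i) := by
      rw [div_le_div_iff₀ (by linarith) (by positivity)]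
      linarith
    have h2 : (1 / (⌊(R i / η) ^ (1 / α i)⌋₊ : ℝ)) ^ α i ≤ 2 ^ α i * (η / R i) := by
      refine (Real.rpow_le_rpow (by positivity) h1 (hα i).le).trans (le_of_eq ?_)
      rw [Real.div_rpow (by norm_num) (by positivity), ← Real.rpow_mul hRη.le,
        one_div_mul_cancel (hα i).ne', Real.rpow_one, div_eq_mul_inv, inv_div]
    have h3 : (2 : ℝ) ^ α i ≤ 2 ^ (r + 1) := by
      rw [← Real.rpow_natCast]
      refine Real.rpow_le_rpow_of_exponent_le (by norm_num) ?_
      have : (holderOrder (α i) : ℝ) ≤ r := by exact_mod_cast hr i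
      push_cast
      linarith [le_holderOrder_add_one (a := α i)]
    calc _ ≤ R i * (2 ^ α i * (η / R i)) := mul_le_mul_of_nonneg_left h2 (hR i).le
      _ = 2 ^ α i * η := by
          have := (hR i).ne'
          field_simp
      _ ≤ _ := by gcongr

end Scale

/-! ### The noise -/

section Noise

variable {n : ℕ}

lemma observation_eq {Ω : Type*} (μ : EuclideanSpace ℝ (Fin n)) (σ : ℝ) (ε : Fin n → Ω → ℝ)
    (ω : Ω) :
    observation μ σ ε ω = μ + σ • (WithLp.toLp 2 fun i => ε i ω) := by
  ext i
  simp [observation]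

variable {Ω : Type*} [MeasurableSpace Ω] {P : Measure Ω} [IsProbabilityMeasure P]
  {ε : Fin n → Ω → ℝ}

lemma hasLaw_noise (hε : ∀ i, HasLaw (ε i) (gaussianReal 0 1) P) (hind : iIndepFun ε P) :
    HasLaw (fun ω => WithLp.toLp 2 fun i => ε i ω) (stdGaussian (EuclideanSpace ℝ (Fin n))) P := by
  have h1 := (iIndepFun_iff_map_fun_eq_pi_map fun i => (hε i).aemeasurable).1 hind
  simp only [fun i => (hε i).map_eq] at h1
  have h2 : AEMeasurable (fun ω i => ε i ω) P := aemeasurable_pi_lambda _ fun i => (hε i).aemeasurable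
  have h3 : HasLaw (WithLp.toLp 2) (stdGaussian (EuclideanSpace ℝ (Fin n)))
      (Measure.pi fun _ : Fin n => gaussianReal 0 1) :=
    ⟨by fun_prop, map_pi_eq_stdGaussian⟩
  exact h3.fun_comp ⟨h2, h1⟩

end Noise

/-! ### Risk over Hölder classes -/

section Risk

/-- Bound on the uniform error of approximation, relative to the accuracy. -/
noncomputable def biasConst (d r : ℕ) : ℝ :=
  lebesgueBound r ^ d * (d * ((1 + lebesgueBound r) * 2 ^ (r + 1)))

variable {d n : ℕ} {x : Fin n → Fin d → ℝ}

/-- A model of small dimension and small bias. -/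
lemma exists_model (hd : 1 ≤ d) (hn : 4 ≤ n) (hx : ∀ i, x i ∈ unitCube d) {r : ℕ}
    {α R : Fin d → ℝ} (hα : ∀ i, 0 < α i) (hR : ∀ i, 0 < R i)
    (hr : ∀ i, holderOrder (α i) ≤ r) {η : ℝ} (hη : 0 < η) (hηR : ∀ i, η ≤ R i)
    (hηn : (meanRadius α R / η) ^ ((d : ℝ) / meanSmoothness α) ≤ n / (2 * ((r : ℝ) + 1) ^ d))
    {f : (Fin d → ℝ) → ℝ} (hf : f ∈ holderClass α R) :
    ∃ m : ModelIndex d n, 2 * weight m ≤ n ∧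
      (weight m : ℝ) ≤ ((r : ℝ) + 1) ^ d
        * (meanRadius α R / η) ^ ((d : ℝ) / meanSmoothness α) ∧
      ‖meanVector f x - leastSquares x m (meanVector f x)‖ ^ 2 ≤ n * (biasConst d r * η) ^ 2 := by
  obtain ⟨k, hk, hkX, hkη⟩ := exists_partition hα hR hr hη hηR
  rw [prod_rpow_one_div hd hα hR hη] at hkX
  have hw : (((r + 1) ^ d * ∏ i, k i : ℕ) : ℝ) ≤ ((r : ℝ) + 1) ^ d
      * (meanRadius α R / η) ^ ((d : ℝ) / meanSmoothness α) := by
    push_cast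
    gcongr
  have hwn : 2 * ((r + 1) ^ d * ∏ i, k i) ≤ n := by
    have h0 : (0 : ℝ) < 2 * ((r : ℝ) + 1) ^ d := by positivity
    rw [le_div_iff₀ h0] at hηn
    have : (2 : ℝ) * (((r + 1) ^ d * ∏ i, k i : ℕ) : ℝ) ≤ n := by nlinarith
    exact_mod_cast this
  -- From `2 * weight ≤ n` and `n ≥ 4` follows `weight + 2 ≤ n`, so the index is admissible.
  refine ⟨⟨(r, k), hk, by simp only; omega⟩, hwn, hw, ?_⟩
  obtain ⟨g, hg, hfg⟩ := exists_piecewisePolynomial_approx hf hα (fun i => (hR i).le) hr hk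
  have hL := one_le_lebesgueBound r
  have hbias {t : Fin d → ℝ} (ht : t ∈ unitCube d) : |f t - g t| ≤ biasConst d r * η := by
    refine (hfg t ht).trans ?_
    have : ∑ i, (1 + lebesgueBound r) * (R i * (1 / (k i : ℝ)) ^ α i)
        ≤ ∑ _i : Fin d, (1 + lebesgueBound r) * (2 ^ (r + 1) * η) :=
      Finset.sum_le_sum fun i _ => mul_le_mul_of_nonneg_left (hkη i) (by linarith)
    refine (mul_le_mul_of_nonneg_left this (by positivity)).trans (le_of_eq ?_)
    simp only [Finset.sum_const, Finset.card_univ, Fintype.card_fin, nsmul_eq_mul, biasConst]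
    ring
  have hproj := norm_sub_starProjection_le (model x ⟨(r, k), hk, by simp only; omega⟩)
    (meanVector f x) (g := evalAt x g) ⟨g, hg, rfl⟩
  refine (pow_le_pow_left₀ (norm_nonneg _) hproj 2).trans ?_
  rw [EuclideanSpace.real_norm_sq_eq]
  have (i : Fin n) : (meanVector f x - evalAt x g) i ^ 2 ≤ (biasConst d r * η) ^ 2 := by
    rw [← sq_abs]
    exact pow_le_pow_left₀ (abs_nonneg _) (hbias (hx i)) 2
  refine (Finset.sum_le_sum fun i _ => this i).trans (le_of_eq ?_)
  simp

/-- The constant in the risk bound. -/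
noncomputable def riskConst (K : ℝ) (d r : ℕ) : ℝ :=
  (1 - 1 / K)⁻¹ * (((1 + K * (4 * 48 ^ 4)) * biasConst d r ^ 2
    + 2 * (K * (4 * 48 ^ 4)) * ((r : ℝ) + 1) ^ d + K * (24 * 2 ^ (d + 1)))
    * (2 * ((r : ℝ) + 1) ^ d) ^ (2 * (r + 1)))

lemma riskConst_pos {K : ℝ} (hK : 1 < K) (d r : ℕ) : 0 < riskConst K d r := by
  have hK0 : 0 < K := by linarith
  have hc : 0 < 1 - 1 / K := by
    rw [sub_pos, div_lt_one hK0]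
    exact hK
  unfold riskConst
  positivity

/-- Combination of the oracle inequality with the properties of a given model. -/
lemma risk_combination {K c₁ c₂ c₃ s σ η N p w B X I : ℝ} (hN : 0 < N)
    (hc₂ : 0 ≤ c₂) (hc₃ : 0 ≤ c₃) (hs : 0 ≤ s) (hp : p * N ≤ c₂ * w)
    (hwN : 2 * w ≤ N) (hwX : w ≤ s * X) (hX : 1 ≤ X) (hB0 : 0 ≤ B) (hB : B ≤ N * (c₁ * η) ^ 2)
    (hXη : X * σ ^ 2 / N ≤ η ^ 2)
    (h : (1 - 1 / K) * I ≤ B + p * (2 * B + 2 * σ ^ 2 * N) + c₃ * σ ^ 2) :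
    (1 - 1 / K) * (I / N) ≤ ((1 + c₂) * c₁ ^ 2 + 2 * c₂ * s + c₃) * η ^ 2 := by
  rw [div_le_iff₀ hN] at hXη
  have hp2 : 2 * p ≤ c₂ := by
    have : p * N * 2 ≤ c₂ * N := by nlinarith
    nlinarith
  have h1 : p * (2 * B) ≤ c₂ * B := by nlinarith
  have h2 : p * (2 * σ ^ 2 * N) ≤ 2 * c₂ * s * (η ^ 2 * N) := by
    have h3 : p * N * (2 * σ ^ 2) ≤ c₂ * w * (2 * σ ^ 2) :=
      mul_le_mul_of_nonneg_right hp (by positivity)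
    have h4 : c₂ * (w * (2 * σ ^ 2)) ≤ c₂ * (s * X * (2 * σ ^ 2)) :=
      mul_le_mul_of_nonneg_left (mul_le_mul_of_nonneg_right hwX (by positivity)) hc₂
    have h5 : 2 * c₂ * s * (X * σ ^ 2) ≤ 2 * c₂ * s * (η ^ 2 * N) :=
      mul_le_mul_of_nonneg_left hXη (by positivity)
    linarith
  -- There is at least one cell, so the remainder of the oracle inequality is absorbed by the
  -- variance term.
  have h6 : c₃ * σ ^ 2 ≤ c₃ * (η ^ 2 * N) := by
    refine mul_le_mul_of_nonneg_left (le_trans ?_ hXη) hc₃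
    exact le_mul_of_one_le_left (sq_nonneg σ) hX
  have h7 : (1 + c₂) * B ≤ (1 + c₂) * (N * (c₁ * η) ^ 2) :=
    mul_le_mul_of_nonneg_left hB (by linarith)
  rw [← mul_div_assoc, div_le_iff₀ hN]
  nlinarith

end Risk

end SignalEstimation

theorem corollary3 (K : ℝ) (hK : 1 < K) (d : ℕ) (hd : 1 ≤ d) (r : ℕ) :
    ∃ C : ℝ, 0 < C ∧
      ∀ (n : ℕ), 14 ≤ n →
      ∀ (x : Fin n → Fin d → ℝ), (∀ i, x i ∈ unitCube d) →
      ∀ (σ : ℝ), 0 < σ →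
      ∀ (α R : Fin d → ℝ), (∀ i, 0 < α i) → (∀ i, 0 < R i) → maxOrder α = r →
      (∀ i, meanRadius α R ^ (d : ℝ) * σ ^ (2 * meanSmoothness α)
        ≤ (n : ℝ) ^ meanSmoothness α * R i ^ (2 * meanSmoothness α + d)) →
      (∀ i, (2 : ℝ) ^ meanSmoothness α * meanRadius α R ^ (d : ℝ)
          * ((r : ℝ) + 1) ^ (d * meanSmoothness α)
        ≤ (n : ℝ) ^ meanSmoothness α * R i ^ (d : ℝ)) →
      ∀ f ∈ holderClass α R,
      ∀ (Ω : Type*) [MeasurableSpace Ω] (P : Measure Ω) [IsProbabilityMeasure P]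
        (ε : Fin n → Ω → ℝ), (∀ i, HasLaw (ε i) (gaussianReal 0 1) P) → iIndepFun ε P →
      ∀ (mhat : EuclideanSpace ℝ (Fin n) → ModelIndex d n), Measurable mhat →
        (∀ᵐ ω ∂P, ∀ m : ModelIndex d n,
          criterion K x (observation (meanVector f x) σ ε ω)
              (mhat (observation (meanVector f x) σ ε ω))
            ≤ criterion K x (observation (meanVector f x) σ ε ω) m) →
        Integrable (fun ω => ‖meanVector f x
          - leastSquares x (mhat (observation (meanVector f x) σ ε ω))
              (observation (meanVector f x) σ ε ω)‖ ^ 2 / (n : ℝ)) P ∧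
        ∫ ω, ‖meanVector f x
          - leastSquares x (mhat (observation (meanVector f x) σ ε ω))
              (observation (meanVector f x) σ ε ω)‖ ^ 2 / (n : ℝ) ∂P
          ≤ C * max
              ((meanRadius α R ^ ((d : ℝ) / meanSmoothness α) * σ ^ 2 / (n : ℝ))
                ^ (2 * meanSmoothness α / (2 * meanSmoothness α + d)))
              (meanRadius α R ^ 2 / (n : ℝ) ^ (2 * meanSmoothness α / d)) := by
  refine ⟨riskConst K d r, riskConst_pos hK d r, ?_⟩
  intro n hn x hx σ hσ α R hα hR hmax h1 h2 f hf Ω _ P _ ε hε hind mhat hmhat hmin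
  have hK0 : 0 < K := by linarith
  have hn0 : (0 : ℝ) < n := by
    have : 0 < n := by omega
    exact_mod_cast this
  have hr (i) : holderOrder (α i) ≤ r :=
    hmax ▸ Finset.le_sup (f := fun i => holderOrder (α i)) (Finset.mem_univ i)
  obtain ⟨η, hη, hηR, hηn, hησ, hηrate⟩ :=
    exists_accuracy hd (by omega : 1 ≤ n) hσ hα hR hr h1 h2
  obtain ⟨m, hmn, hmX, hmB⟩ := exists_model hd (by omega) hx hα hR hr hη hηR hηn hf
  have hX1 : 1 ≤ (meanRadius α R / η) ^ ((d : ℝ) / meanSmoothness α) := by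
    rw [← prod_rpow_one_div hd hα hR hη]
    refine le_trans (by simp) (Finset.prod_le_prod (f := fun _ => (1 : ℝ))
      (fun _ _ => zero_le_one) fun i _ => ?_)
    exact Real.one_le_rpow ((one_le_div hη).2 (hηR i)) (one_div_pos.2 (hα i)).le
  simp only [observation_eq] at hmin ⊢
  obtain ⟨hint, hrisk⟩ := oracle_inequality hd hx hK hσ (meanVector f x) (hasLaw_noise hε hind)
    hmhat hmin m
  simp only [selectionLoss] at hint hrisk
  refine ⟨hint.div_const _, ?_⟩
  rw [integral_div]
  have hc : 0 < 1 - 1 / K := by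
    rw [sub_pos, div_lt_one hK0]
    exact hK
  -- Here `c₁ = biasConst d r`, `c₂ = K * (4 * 48 ^ 4)`, `c₃ = K * (24 * 2 ^ (d + 1))`, `s = (r + 1)
  -- ^ d`, and `X` is the bound on the number of cells.
  have hfin := risk_combination hn0 (by positivity) (by positivity) (by positivity)
    (penalty_div_le hx hK0.le m hmn) (by exact_mod_cast hmn)
    hmX hX1 (sq_nonneg _) hmB hησ
    (hrisk.trans (le_of_eq (by ring : _ = _ + _ + K * (24 * 2 ^ (d + 1)) * σ ^ 2)))
  refine ((le_div_iff₀' hc).2 hfin).trans ?_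
  rw [div_eq_inv_mul _ (1 - 1 / K), riskConst, mul_assoc _ _ (max _ _), mul_assoc _ _ (max _ _)]
  refine mul_le_mul_of_nonneg_left ?_ (inv_pos.2 hc).le
  exact mul_le_mul_of_nonneg_left hηrate (by positivity)
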